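/- **Setting.** Let $n,m,s,T$ be positive integers with $T\ge 2$. Let $G=(V,E)$ be a strongly connected directed graph on $V=\{1,\dots,n\}$, $N_i=\{j\ne i:(j,i)\in E\}$, and let $W\in\mathbb R^{n\times n}$ be a doubly stochastic matrix with nonnegative entries such that, for $i\neq j$, $[W]_{ij}>0$ if and only if $j\in N_i$. Let $\sigma_2(W)$ be its second largest singular value ($\sigma_2(W)=0$ if $n=1$). Let $R,K_I>0$, let $k_1,\dots,k_s\in\mathbb R^m$ satisfy $\|k_q\|\le K_I$, and let the decision set be $\mathcal K=\{y\in\mathbb R^m:\ k_q^{\mathsf T}y\le 0 \text{ for } q=1,\dots,s\}\cap\mathbb B_R^m$, where $\mathbb B_R^m=\{y:\|y\|\le R\}$. The data $(h_i(t),z_i(t))\in\mathbb R^m\times\mathbb R$ ($i\in V$, $1\le t\le T$) are arbitrary but fixed in advance, with $\|h_i(t)\|^2\le\alpha_h$ and $|z_i(t)|\le\alpha_z$, and for at least one $t\in\{1,\dots,T\}$ the $n\times m$ matrix with rows $h_i(t)^{\mathsf T}$ has rank $m$. Put $L=\alpha_hR+\sqrt{\alpha_h}\,\alpha_z$, $\theta_{i,t}(y)=\frac12(h_i(t)^{\mathsf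 T}y-z_i(t))^2$ and $[a]_+=\max\{0,a\}$, and let $y^\star$ be a minimizer of $\sum_{t=1}^T\sum_{j=1}^n\theta_{j,t}(y)$ over $y\in\mathcal K$. **Algorithm DOLR-BFC.** Let $\beta\in(0,1)$, $\gamma\ge\beta$, $c>1$ and $$\eta=\frac1{c\,s\,K_I^2T^\beta},\qquad \pi=\frac1{T^\beta},\qquad \epsilon=\frac1{T^\gamma},\qquad \xi=\frac1{R\,T^\gamma}.$$ Start from any $x_i(1)\in\mathcal K$ and $\mu_i(1)=0\in\mathbb R^s$. Let $u_i(t)$ ($i\in V$, $1\le t\le T$) be independent random vectors, uniformly distributed on the unit sphere of $\mathbb R^m$. In round $t$ each node $i$ computes $$g_i(t)=\frac m{2\epsilon}\big(\theta_{i,t}(x_i(t)+\epsilon u_i(t))-\theta_{i,t}(x_i(t)-\epsilon u_i(t))\big)u_i(t),$$ $$l_i(t)=x_i(t)-\eta\Big(g_i(t)+\sum_{q=1}^s[\mu_i(t)]_q\,\partial[k_q^{\mathsf T}x_i(t)]_+\Big),$$ where $\partial[k_q^{\mathsf T}x]_+$ is $k_q$ if $k_q^{\mathsf T}x>0$ and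 $0$ otherwise; it then sets $x_i(t+1)$ to be the Euclidean projection of $[W]_{ii}l_i(t)+\sum_{j\in N_i}[W]_{ij}l_j(t)$ onto $(1-\xi)\mathbb B^m_R$ and $[\mu_i(t+1)]_q=[k_q^{\mathsf T}x_i(t+1)]_+/\pi$ for $q=1,\dots,s$. Let $$\mathrm{Regret}(i,T)=\sum_{t=1}^T\sum_{j=1}^n\big(\theta_{j,t}(x_i(t))-\theta_{j,t}(y^\star)\big),\qquad \mathrm{CV}(s,T)=\sum_{t=1}^T\sum_{i=1}^n\sum_{q=1}^s[k_q^{\mathsf T}x_i(t)]_+ .$$ **Theorem.** If all self-weights $[W]_{ii}$ are positive, then $\sigma_2(W)<1$. Whenever $\sigma_2(W)<1$, the random variables $\mathrm{Regret}(i,T)$ and $\mathrm{CV}(s,T)$ are integrable, and for all $i\in V$ and all $T\ge 2$ $$\mathbb E[\mathrm{Regret}(i,T)]\le F_G\,T^{\max\{\beta,1-\beta\}},\qquad \mathbb E[\mathrm{CV}(s,T)]\le F_G^\dagger\,T^{1-\beta/2},$$ where $$F_G=\mathcal O\Big(\frac{1}{(1-\sigma_2(W))^2}\big(m^2n^{5/2}L^2+n^{5/2}LR+n^4L^2\big)+nK_I^2R^2\Big),\qquad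 F_G^\dagger=\mathcal O(m\,n\,L\,K_I\,R).$$ Here $\mathcal O$ is uniform for $L,K_I,R$ bounded away from $0$: for all $c>1$, $s\ge1$ and $\delta>0$ there is a constant $C$, depending only on $c,s,\delta$, such that $F_G$ and $F_G^\dagger$ can be taken to be $C$ times the expressions in parentheses whenever $L,K_I,R\ge\delta$ (with no restriction on the other quantities, on the data, on the network, or on the initial estimates). -/

import Mathlib

open MeasureTheory ProbabilityTheory
open scoped Pointwise

namespace DOLR

/-- `ℝ^m` with the Euclidean norm. -/
abbrev Vec (m : ℕ) := EuclideanSpace ℝ (Fin m)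

/-- Standing conditions on the directed graph `G` on the nodes `Fin n` and its weight matrix `W`.
`G.Adj j i` is the edge `(j, i)`, i.e. `j` is an in-neighbour of `i`: node `i` receives the
messages of node `j`. The self-weights `W i i` are only required to be nonnegative. -/
structure IsNetwork {n : ℕ} (G : Digraph (Fin n)) (W : Matrix (Fin n) (Fin n) ℝ) : Prop where
  strongly_connected : ∀ i j, Relation.ReflTransGen G.Adj i j
  nonneg : ∀ i j, 0 ≤ W i j
  pos_iff : ∀ i j, i ≠ j → (0 < W i j ↔ G.Adj j i)
  row_sum : ∀ i, ∑ j, W i j = 1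
  col_sum : ∀ j, ∑ i, W i j = 1

/-- The second largest singular value (Mathlib's decreasing list starts at index `0`;
the value is `0` if `n = 1`). -/
noncomputable def sigma2 {n : ℕ} (W : Matrix (Fin n) (Fin n) ℝ) : ℝ :=
  (Matrix.toEuclideanLin W).singularValues 1

/-- Square loss `θ(y) = (hᵀ y - z)² / 2`. -/
noncomputable def loss {m : ℕ} (h : Vec m) (z : ℝ) (y : Vec m) : ℝ :=
  (1 / 2) * (inner ℝ h y - z) ^ 2

/-- The decision set: the points `y` of the ball of radius `R` with `k_qᵀ y ≤ 0` for all `q`. -/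
def decisionSet {m s : ℕ} (k : Fin s → Vec m) (R : ℝ) : Set (Vec m) :=
  {y | (∀ q, inner ℝ (k q) y ≤ 0) ∧ ‖y‖ ≤ R}

/-- The (unique) uniform probability distribution on the unit sphere of `ℝ^m`, `m ≥ 1`. -/
noncomputable def uniformSphere (m : ℕ) : Measure (Vec m) :=
  (((volume : Measure (Vec m)).toSphere Set.univ)⁻¹ •
    (volume : Measure (Vec m)).toSphere).map Subtype.val

/-- Two-point estimate at `y` of the gradient of `θ`, with query radius `ε` and direction `u`. -/
noncomputable def gradEst {m : ℕ} (ε : ℝ) (θ : Vec m → ℝ) (u y : Vec m) : Vec m :=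
  ((m : ℝ) / (2 * ε) * (θ (y + ε • u) - θ (y - ε • u))) • u

/-- The constraint violation `[kᵀ y]₊`. -/
noncomputable def viol {m : ℕ} (k y : Vec m) : ℝ := max 0 (inner ℝ k y)

/-- The subgradient of `y ↦ [kᵀ y]₊` used by the algorithm. -/
noncomputable def violGrad {m : ℕ} (k y : Vec m) : Vec m :=
  if 0 < inner ℝ k y then k else 0

/-- Euclidean projection of `x` onto `A`: a nearest point of `A`
(which exists and is unique if `A` is nonempty, closed and convex). -/
noncomputable def proj {m : ℕ} (A : Set (Vec m)) (x : Vec m) : Vec m :=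
  Classical.epsilon fun y => y ∈ A ∧ ∀ w ∈ A, ‖x - y‖ ≤ ‖x - w‖

/-- The estimates `x i` and the dual vectors `mu i` of all nodes at the beginning of a round. -/
structure State (n m s : ℕ) where
  x : Fin n → Vec m
  mu : Fin n → Fin s → ℝ

section Algorithm

variable {n m s : ℕ}

/-- Local gradient step of node `i`, from its state, its data `(h, z)` (seen only through two
values of its loss) and its random direction `u`. -/
noncomputable def localStep (k : Fin s → Vec m) (η ε : ℝ) (h : Vec m) (z : ℝ) (u : Vec m)
    (x : Vec m) (mu : Fin s → ℝ) : Vec m :=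
  x - η • (gradEst ε (loss h z) u x + ∑ q, mu q • violGrad (k q) x)

/-- The new estimate of node `i`: weighted average of the messages of its neighbours
(`W i j = 0` for the other nodes) and of its own, projected onto the shrunk ball. -/
noncomputable def newEstimate (W : Matrix (Fin n) (Fin n) ℝ) (k : Fin s → Vec m) (R η ε ξ : ℝ)
    (h : Fin n → Vec m) (z : Fin n → ℝ) (u : Fin n → Vec m) (S : State n m s) (i : Fin n) :
    Vec m :=
  proj ((1 - ξ) • Metric.closedBall (0 : Vec m) R)
    (∑ j, W i j • localStep k η ε (h j) (z j) (u j) (S.x j) (S.mu j))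

/-- One round of the algorithm DOLR-BFC at all nodes (`reg` is the regularization parameter
of the augmented Lagrangian). -/
noncomputable def round (W : Matrix (Fin n) (Fin n) ℝ) (k : Fin s → Vec m) (R η reg ε ξ : ℝ)
    (h : Fin n → Vec m) (z : Fin n → ℝ) (u : Fin n → Vec m) (S : State n m s) : State n m s where
  x := newEstimate W k R η ε ξ h z u S
  mu := fun i q => viol (k q) (newEstimate W k R η ε ξ h z u S i) / reg

/-- The run of DOLR-BFC on the data `h, z`, with initial estimates `x₁`, zero initial dual vectors
and directions `u`. Rounds are numbered from `0`: index `t` is round `t + 1`. -/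
noncomputable def run (W : Matrix (Fin n) (Fin n) ℝ) (k : Fin s → Vec m) (R η reg ε ξ : ℝ)
    (h : ℕ → Fin n → Vec m) (z : ℕ → Fin n → ℝ) (x₁ : Fin n → Vec m) (u : ℕ → Fin n → Vec m) :
    ℕ → State n m s
  | 0 => ⟨x₁, fun _ _ => 0⟩
  | t + 1 => round W k R η reg ε ξ (h t) (z t) (u t) (run W k R η reg ε ξ h z x₁ u t)

/-- Network-wide loss over `T` rounds of the predictors `y 0, …, y (T - 1)`. -/
noncomputable def totalLoss (T : ℕ) (h : ℕ → Fin n → Vec m) (z : ℕ → Fin n → ℝ)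
    (y : ℕ → Vec m) : ℝ :=
  ∑ t ∈ Finset.range T, ∑ j, loss (h t j) (z t j) (y t)

/-- Regret of node `i` over `T` rounds with respect to `ystar`, for the states `S`. -/
noncomputable def regret (T : ℕ) (h : ℕ → Fin n → Vec m) (z : ℕ → Fin n → ℝ)
    (ystar : Vec m) (S : ℕ → State n m s) (i : Fin n) : ℝ :=
  totalLoss T h z (fun t => (S t).x i) - totalLoss T h z (fun _ => ystar)

/-- Network-wide cumulative constraint violation over `T` rounds. -/
noncomputable def cumViol (T : ℕ) (k : Fin s → Vec m) (S : ℕ → State n m s) : ℝ :=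
  ∑ t ∈ Finset.range T, ∑ i, ∑ q, viol (k q) ((S t).x i)

end Algorithm

end DOLR

namespace DOLR

/-! ### Doubly stochastic averaging and its second singular value. -/

section Network

variable {E : Type*} [NormedAddCommGroup E] [InnerProductSpace ℝ E]

/-! Since the initial estimates are feasible, the dual vector is always the current violation
divided by the regularization parameter. The method is therefore a primal gradient method for the
loss plus a quadratic penalty of weight `τ = T ^ β`, followed by averaging and projection
(`isTrajectory_run`).

Compare it with a feasible point `y` of the shrunk ball. The step size satisfies `η * τ * (s * K ^
2) * c = 1`, so the squared penalty step is absorbed by half of the decrease that the penalty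
produces (`norm_step_sub_sq_le`). Averaging and projection do not increase the total squared
distance to `y`, so the inequality telescopes (`IsTrajectory.sum_inner_le`). Divided by `2 * η`, it
bounds the linearized regret plus `τ / 2` times the sum of the squared violations by terms of order
`T ^ β` and `T ^ (1 - β)`.

The regret of node `i` evaluates all losses at the estimate of `i`, which costs the disagreement
between nodes. Averaging contracts deviations from the mean by `sigma2 W`, and each round perturbs
them by the loss step, the shrinkage and the square root of the squared violations
(`IsTrajectory.sum_dispersion_le`). Young's inequality pays for that last term with the penalty term
above, at a price quadratic in `1 / (1 - sigma2 W)`. This gives `IsTrajectory.regret_add_noise_le`.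
For the violations, the linearized regret is at least of order `-T`, so the squared violations sum
to order `T / τ`, and Young's inequality gives `T / √τ` (`IsTrajectory.sum_viol_add_noise_le`).

Both bounds hold along almost every path, up to a noise term linear in the gradient errors. For a
quadratic loss the two-point estimate has no bias, and the estimates of a round are independent of
its directions, so the noise has mean zero (`integral_gradient_error`, `integral_noise`). If the
shrinkage parameter exceeds `1`, then `T ^ β` is below `1 / δ` and trivial bounds suffice.

That `sigma2 W < 1` for positive self-weights follows from the equality case of Jensen's inequality
(`IsNetwork.sigma2_lt_one`). -/

lemma sum_weighted_norm_sub_sq {ι : Type*} [Fintype ι] (w : ι → ℝ) (hw : ∑ j, w j = 1)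
    (v : ι → E) :
    ∑ j, w j * ‖v j - ∑ l, w l • v l‖ ^ 2 = ∑ j, w j * ‖v j‖ ^ 2 - ‖∑ l, w l • v l‖ ^ 2 := by
  set a := ∑ l, w l • v l with ha
  have h1 : ∑ j, w j * inner ℝ (v j) a = ‖a‖ ^ 2 := by
    rw [← real_inner_self_eq_norm_sq, ha, sum_inner]
    simp only [real_inner_smul_left]
  have h2 : ∀ j, w j * ‖v j - a‖ ^ 2
      = w j * ‖v j‖ ^ 2 - 2 * (w j * inner ℝ (v j) a) + w j * ‖a‖ ^ 2 := by
    intro j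
    rw [norm_sub_sq_real]; ring
  simp only [h2]
  rw [Finset.sum_add_distrib, Finset.sum_sub_distrib, ← Finset.mul_sum, h1, ← Finset.sum_mul, hw]
  ring

variable {n : ℕ} {G : Digraph (Fin n)} {W : Matrix (Fin n) (Fin n) ℝ}

lemma IsNetwork.sum_sum_mul (hW : IsNetwork G W) (f : Fin n → ℝ) :
    ∑ i, ∑ j, W i j * f j = ∑ j, f j := by
  rw [Finset.sum_comm]
  simp only [← Finset.sum_mul, hW.col_sum, one_mul]

lemma IsNetwork.norm_sq_average_le (hW : IsNetwork G W) (v : Fin n → E) (i : Fin n) :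
    ‖∑ j, W i j • v j‖ ^ 2 ≤ ∑ j, W i j * ‖v j‖ ^ 2 := by
  have h := sum_weighted_norm_sub_sq (W i) (hW.row_sum i) v
  have : 0 ≤ ∑ j, W i j * ‖v j - ∑ l, W i l • v l‖ ^ 2 :=
    Finset.sum_nonneg fun j _ => mul_nonneg (hW.nonneg i j) (sq_nonneg _)
  linarith

lemma IsNetwork.sum_norm_sq_average_le (hW : IsNetwork G W) (v : Fin n → E) :
    ∑ i, ‖∑ j, W i j • v j‖ ^ 2 ≤ ∑ j, ‖v j‖ ^ 2 :=
  (Finset.sum_le_sum fun i _ => hW.norm_sq_average_le v i).trans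
    (hW.sum_sum_mul fun j => ‖v j‖ ^ 2).le

/-- Averaging with positive self-weights preserves the energy of constant vectors only. -/
lemma IsNetwork.eq_of_sum_norm_sq_average_eq (hW : IsNetwork G W) (hd : ∀ j, 0 < W j j)
    (v : Fin n → E) (hv : ∑ i, ‖∑ j, W i j • v j‖ ^ 2 = ∑ j, ‖v j‖ ^ 2) (i j : Fin n) :
    v i = v j := by
  have h0 : ∑ i, ∑ j, W i j * ‖v j - ∑ l, W i l • v l‖ ^ 2 = 0 := by
    simp only [fun i => sum_weighted_norm_sub_sq (W i) (hW.row_sum i) v]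
    rw [Finset.sum_sub_distrib, hW.sum_sum_mul, hv, sub_self]
  have hnn : ∀ i j, 0 ≤ W i j * ‖v j - ∑ l, W i l • v l‖ ^ 2 := fun i j =>
    mul_nonneg (hW.nonneg i j) (sq_nonneg _)
  have h1 : ∀ i j, 0 < W i j → v j = ∑ l, W i l • v l := by
    intro i j hij
    have := (Finset.sum_eq_zero_iff_of_nonneg fun i _ =>
      Finset.sum_nonneg fun j _ => hnn i j).1 h0 i (Finset.mem_univ i)
    have := (Finset.sum_eq_zero_iff_of_nonneg fun j _ => hnn i j).1 this j (Finset.mem_univ j)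
    rcases mul_eq_zero.1 this with h | h
    · exact absurd h hij.ne'
    · exact sub_eq_zero.1 (norm_eq_zero.1 (pow_eq_zero_iff two_ne_zero |>.1 h))
  -- Along an edge from `i` to `j`, both `i` and `j` carry positive weight in row `j`, so both
  -- values equal the average formed at `j`.
  have hadj : ∀ i j, G.Adj i j → v i = v j := by
    intro i j hij
    by_cases e : i = j
    · rw [e]
    · rw [h1 j i ((hW.pos_iff j i (Ne.symm e)).2 hij), ← h1 j j (hd j)]
  induction hW.strongly_connected i j with
  | refl => rfl
  | tail _ h ih => exact ih.trans (hadj _ _ h)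

lemma norm_sq_toEuclideanLin (W : Matrix (Fin n) (Fin n) ℝ) (x : EuclideanSpace ℝ (Fin n)) :
    ‖Matrix.toEuclideanLin W x‖ ^ 2 = ∑ i, ‖∑ j, W i j • x j‖ ^ 2 := by
  rw [EuclideanSpace.norm_sq_eq]
  simp [Matrix.toLpLin_apply, Matrix.mulVec, dotProduct]

section Spectral

variable {F : Type*} [NormedAddCommGroup F] [InnerProductSpace ℝ F] [FiniteDimensional ℝ F]

/-- Parseval's identity for `⟪A* A x, x⟫` in an eigenbasis of `A* A`. -/
lemma norm_sq_apply_eq_sum_eigenvalues (A : F →ₗ[ℝ] F) (hn : Module.finrank ℝ F = n) (x : F) :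
    ‖A x‖ ^ 2 = ∑ i, A.isSymmetric_adjoint_comp_self.eigenvalues hn i *
      (inner ℝ (A.isSymmetric_adjoint_comp_self.eigenvectorBasis hn i) x) ^ 2 := by
  set hA := A.isSymmetric_adjoint_comp_self
  rw [← real_inner_self_eq_norm_sq, ← LinearMap.adjoint_inner_left, ← LinearMap.comp_apply,
    ← (hA.eigenvectorBasis hn).sum_inner_mul_inner]
  refine Finset.sum_congr rfl fun i _ => ?_
  have h := hA.eigenvectorBasis_apply_self_apply hn x i
  rw [OrthonormalBasis.repr_apply_apply, OrthonormalBasis.repr_apply_apply,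
    real_inner_comm] at h
  rw [h]
  simp only [RCLike.ofReal_real_eq_id, id_eq]
  ring

end Spectral

lemma IsNetwork.norm_toEuclideanLin_le (hW : IsNetwork G W) (x : EuclideanSpace ℝ (Fin n)) :
    ‖Matrix.toEuclideanLin W x‖ ≤ ‖x‖ := by
  refine le_of_sq_le_sq ?_ (norm_nonneg _)
  rw [norm_sq_toEuclideanLin, EuclideanSpace.norm_sq_eq]
  exact hW.sum_norm_sq_average_le _

lemma eigenvalues_eq_norm_sq (W : Matrix (Fin n) (Fin n) ℝ) (i : Fin n) :
    (Matrix.toEuclideanLin W).isSymmetric_adjoint_comp_self.eigenvalues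
        finrank_euclideanSpace_fin i =
      ‖Matrix.toEuclideanLin W ((Matrix.toEuclideanLin
        W).isSymmetric_adjoint_comp_self.eigenvectorBasis finrank_euclideanSpace_fin i)‖ ^ 2 := by
  rw [norm_sq_apply_eq_sum_eigenvalues _ finrank_euclideanSpace_fin,
    Finset.sum_eq_single i]
  · simp
  · intro j _ hj
    rw [OrthonormalBasis.inner_eq_ite]
    simp [hj]
  · simp

lemma sigma2_nonneg (W : Matrix (Fin n) (Fin n) ℝ) : 0 ≤ sigma2 W :=
  LinearMap.singularValues_nonneg _ _

/-- Otherwise two orthonormal eigenvectors of `Wᵀ W` keep their norm under `W`. Both are then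
constant vectors, and two nonzero constant vectors are not orthogonal. -/
lemma IsNetwork.sigma2_lt_one (hW : IsNetwork G W) (hd : ∀ j, 0 < W j j) : sigma2 W < 1 := by
  by_cases hn : n ≤ 1
  · rw [sigma2, LinearMap.singularValues_of_finrank_le _ (by simpa using hn)]
    exact one_pos
  push Not at hn
  set A := Matrix.toEuclideanLin W with hA
  have hfr : Module.finrank ℝ (EuclideanSpace ℝ (Fin n)) = n := finrank_euclideanSpace_fin
  set b := A.isSymmetric_adjoint_comp_self.eigenvectorBasis hfr with hb
  by_contra hcon
  push Not at hcon
  have key : ∀ a : Fin n, a.1 ≤ 1 → ∀ i j, b a i = b a j := by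
    intro a ha
    have h1 : 1 ≤ A.singularValues a :=
      hcon.trans (A.singularValues_antitone ha)
    have h2 : 1 ≤ ‖A (b a)‖ ^ 2 := by
      rw [← eigenvalues_eq_norm_sq W a, ← LinearMap.sq_singularValues_fin]
      exact one_le_pow₀ h1
    have h3 : ‖A (b a)‖ ≤ ‖b a‖ := hW.norm_toEuclideanLin_le _
    have h4 : ‖b a‖ = 1 := b.norm_eq_one a
    have h5 : ‖A (b a)‖ ^ 2 = ‖b a‖ ^ 2 := by
      refine le_antisymm (pow_le_pow_left₀ (norm_nonneg _) h3 2) ?_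
      rw [h4]; simpa using h2
    rw [norm_sq_toEuclideanLin, EuclideanSpace.norm_sq_eq] at h5
    exact hW.eq_of_sum_norm_sq_average_eq hd _ h5
  let p : Fin n := ⟨0, by omega⟩
  let q : Fin n := ⟨1, hn⟩
  have hp := key p (by simp [p])
  have hq := key q (by simp [q])
  have hpq : inner ℝ (b p) (b q) = 0 := by
    rw [OrthonormalBasis.inner_eq_ite]
    simp [p, q]
  have hin : ∀ x y : EuclideanSpace ℝ (Fin n), (∀ i j, x i = x j) → (∀ i j, y i = y j) →
      inner ℝ x y = n * (x p * y p) := by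
    intro x y hx hy
    rw [PiLp.inner_apply]
    simp only [fun i => hx i p, fun i => hy i p]
    simp [mul_comm]
  have hpp : inner ℝ (b p) (b p) = 1 := by rw [OrthonormalBasis.inner_eq_ite]; simp
  have hqq : inner ℝ (b q) (b q) = 1 := by rw [OrthonormalBasis.inner_eq_ite]; simp
  rw [hin _ _ hp hp] at hpp
  rw [hin _ _ hq hq] at hqq
  rw [hin _ _ hp hq] at hpq
  rcases mul_eq_zero.1 hpq with h | h
  · rw [h] at hpp; simp at hpp
  · rcases mul_eq_zero.1 h with h | h
    · rw [h] at hpp; simp at hpp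
    · rw [h] at hqq; simp at hqq

/-- The all-ones vector keeps its norm, and only the top eigenvalue of `Wᵀ W` can equal `1`, so it
spans the top eigenline. A vector of zero sum has no component there, and the other eigenvalues are
at most `sigma2 W ^ 2`. -/
lemma IsNetwork.norm_toEuclideanLin_le_sigma2 (hW : IsNetwork G W) (hs : sigma2 W < 1)
    (x : EuclideanSpace ℝ (Fin n)) (hx : ∑ i, x i = 0) :
    ‖Matrix.toEuclideanLin W x‖ ^ 2 ≤ sigma2 W ^ 2 * ‖x‖ ^ 2 := by
  by_cases hn : n ≤ 1
  · have hx0 : x = 0 := by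
      ext i
      have : Subsingleton (Fin n) := Fin.subsingleton_iff_le_one.2 hn
      rwa [Fintype.sum_subsingleton _ i] at hx
    simp [hx0]
  push Not at hn
  set A := Matrix.toEuclideanLin W with hA
  have hfr : Module.finrank ℝ (EuclideanSpace ℝ (Fin n)) = n := finrank_euclideanSpace_fin
  set b := A.isSymmetric_adjoint_comp_self.eigenvectorBasis hfr with hb
  set l := A.isSymmetric_adjoint_comp_self.eigenvalues hfr with hl
  let p : Fin n := ⟨0, by omega⟩
  let q : Fin n := ⟨1, hn⟩
  have hlq : l q = sigma2 W ^ 2 := (A.sq_singularValues_fin hfr q).symm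
  have hl1 : ∀ i, l i ≤ 1 := by
    intro i
    rw [hl, eigenvalues_eq_norm_sq W i]
    have := hW.norm_toEuclideanLin_le (b i)
    rw [b.norm_eq_one] at this
    exact pow_le_one₀ (norm_nonneg _) this
  have hlt : ∀ i, i ≠ p → l i ≤ l q := by
    intro i hi
    refine A.isSymmetric_adjoint_comp_self.eigenvalues_antitone hfr ?_
    rw [Fin.le_def]
    have : i.1 ≠ 0 := fun h => hi (Fin.ext h)
    simp only [q]; omega
  have hq1 : l q < 1 := by
    rw [hlq]; exact pow_lt_one₀ (sigma2_nonneg W) hs two_ne_zero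
  let e : EuclideanSpace ℝ (Fin n) := WithLp.toLp 2 fun _ => 1
  have he : ‖A e‖ ^ 2 = ‖e‖ ^ 2 := by
    rw [norm_sq_toEuclideanLin, EuclideanSpace.norm_sq_eq]
    simp [e, hW.row_sum]
  have hpar : ∀ y : EuclideanSpace ℝ (Fin n), ‖y‖ ^ 2 = ∑ i, inner ℝ (b i) y ^ 2 := by
    intro y
    rw [← b.sum_sq_norm_inner_right y]
    simp
  have hce : ∀ i, i ≠ p → inner ℝ (b i) e = 0 := by
    rw [norm_sq_apply_eq_sum_eigenvalues A hfr e, hpar e] at he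
    have h0 : ∑ i, (1 - l i) * inner ℝ (b i) e ^ 2 = 0 := by
      simp only [sub_mul, one_mul, Finset.sum_sub_distrib]
      rw [sub_eq_zero]
      exact he.symm
    intro i hi
    have := (Finset.sum_eq_zero_iff_of_nonneg fun i _ =>
      mul_nonneg (sub_nonneg.2 (hl1 i)) (sq_nonneg _)).1 h0 i (Finset.mem_univ i)
    rcases mul_eq_zero.1 this with h | h
    · linarith [hlt i hi]
    · exact pow_eq_zero_iff two_ne_zero |>.1 h
  have hxe : inner ℝ e x = 0 := by
    rw [PiLp.inner_apply]
    simpa [e] using hx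
  have hxp : inner ℝ (b p) x = 0 := by
    rw [← b.sum_inner_mul_inner, Finset.sum_eq_single p] at hxe
    · rcases mul_eq_zero.1 hxe with h | h
      · exfalso
        have he0 : ‖e‖ ^ 2 = 0 := by
          rw [hpar e]
          refine Finset.sum_eq_zero fun i _ => ?_
          by_cases hi : i = p
          · rw [hi, real_inner_comm, h]; simp
          · rw [hce i hi]; simp
        rw [EuclideanSpace.norm_sq_eq] at he0
        simp [e] at he0
        omega
      · exact h
    · intro i _ hi
      rw [real_inner_comm, hce i hi, zero_mul]
    · simp
  rw [norm_sq_apply_eq_sum_eigenvalues A hfr x, hpar x, Finset.mul_sum]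
  refine Finset.sum_le_sum fun i _ => ?_
  by_cases hi : i = p
  · rw [hi]; simp only [← hb, hxp]; simp
  · rw [← hlq]
    exact mul_le_mul_of_nonneg_right (hlt i hi) (sq_nonneg _)

/-- Averaging contracts the deviations from the mean by the factor `sigma2 W`. -/
lemma IsNetwork.sum_norm_sq_average_le_sigma2 (hW : IsNetwork G W) (hs : sigma2 W < 1) {m : ℕ}
    (v : Fin n → Vec m) (hv : ∑ i, v i = 0) :
    ∑ i, ‖∑ j, W i j • v j‖ ^ 2 ≤ sigma2 W ^ 2 * ∑ j, ‖v j‖ ^ 2 := by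
  have h : ∀ a : Fin m, ∑ i, (∑ j, W i j * v j a) ^ 2 ≤ sigma2 W ^ 2 * ∑ j, (v j a) ^ 2 := by
    intro a
    have := hW.norm_toEuclideanLin_le_sigma2 hs (WithLp.toLp 2 fun j => v j a) (by
      have := congrArg (fun y : Vec m => y a) hv
      simpa using this)
    rw [norm_sq_toEuclideanLin, EuclideanSpace.norm_sq_eq] at this
    simpa using this
  simp only [EuclideanSpace.norm_sq_eq]
  rw [Finset.sum_comm, Finset.sum_comm (f := fun i a => ‖v i a‖ ^ 2), Finset.mul_sum]
  refine Finset.sum_le_sum fun a _ => ?_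
  simpa using h a

end Network

/-! ### Euclidean projection onto closed convex sets. -/

section Projection

variable {m : ℕ} {A : Set (Vec m)}

lemma proj_spec (hne : A.Nonempty) (hcl : IsClosed A) (hcv : Convex ℝ A) (x : Vec m) :
    proj A x ∈ A ∧ ∀ w ∈ A, ‖x - proj A x‖ ≤ ‖x - w‖ := by
  refine Classical.epsilon_spec (p := fun y => y ∈ A ∧ ∀ w ∈ A, ‖x - y‖ ≤ ‖x - w‖) ?_
  obtain ⟨y, hy, h⟩ := exists_norm_eq_iInf_of_complete_convex hne hcl.isComplete hcv x
  refine ⟨y, hy, fun w hw => h.trans_le ?_⟩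
  exact ciInf_le ⟨0, by rintro _ ⟨w, rfl⟩; exact norm_nonneg _⟩ (⟨w, hw⟩ : A)

lemma inner_sub_proj_le_zero (hne : A.Nonempty) (hcl : IsClosed A) (hcv : Convex ℝ A) (x : Vec m)
    {w : Vec m} (hw : w ∈ A) : inner ℝ (x - proj A x) (w - proj A x) ≤ 0 := by
  obtain ⟨h1, h2⟩ := proj_spec hne hcl hcv x
  refine (norm_eq_iInf_iff_real_inner_le_zero hcv h1).1 (le_antisymm ?_ ?_) w hw
  · have : Nonempty A := ⟨⟨_, h1⟩⟩
    exact le_ciInf fun w => h2 w w.2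
  · exact ciInf_le ⟨0, by rintro _ ⟨w, rfl⟩; exact norm_nonneg _⟩ (⟨_, h1⟩ : A)

lemma norm_proj_sub_proj_le (hne : A.Nonempty) (hcl : IsClosed A) (hcv : Convex ℝ A)
    (x y : Vec m) : ‖proj A x - proj A y‖ ≤ ‖x - y‖ := by
  have h1 := inner_sub_proj_le_zero hne hcl hcv x (proj_spec hne hcl hcv y).1
  have h2 := inner_sub_proj_le_zero hne hcl hcv y (proj_spec hne hcl hcv x).1
  set p := proj A x
  set q := proj A y
  have h3 : ‖p - q‖ ^ 2 ≤ inner ℝ (x - y) (p - q) := by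
    rw [← real_inner_self_eq_norm_sq]
    simp only [inner_sub_left, inner_sub_right] at *
    linarith [real_inner_comm p q, real_inner_comm x q, real_inner_comm y p]
  have h4 := real_inner_le_norm (x - y) (p - q)
  by_contra hcon
  push Not at hcon
  nlinarith [norm_nonneg (x - y), norm_nonneg (p - q)]

lemma proj_eq_self (hne : A.Nonempty) (hcl : IsClosed A) (hcv : Convex ℝ A)
    {x : Vec m} (hx : x ∈ A) : proj A x = x := by
  have := (proj_spec hne hcl hcv x).2 x hx
  rw [sub_self, norm_zero] at this
  exact (sub_eq_zero.1 (norm_le_zero_iff.1 this)).symm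

lemma continuous_proj (hne : A.Nonempty) (hcl : IsClosed A) (hcv : Convex ℝ A) :
    Continuous (proj A) := by
  refine (LipschitzWith.of_dist_le_mul (K := 1) fun x y => ?_).continuous
  simpa [dist_eq_norm] using norm_proj_sub_proj_le hne hcl hcv x y

/-- The absolute value matters: `a` is later `1 - ξ`, which can be negative. -/
lemma shrunkBall_eq (a : ℝ) {R : ℝ} (hR : 0 ≤ R) :
    a • Metric.closedBall (0 : Vec m) R = Metric.closedBall (0 : Vec m) (|a| * R) := by
  rw [smul_closedBall _ _ hR, smul_zero, Real.norm_eq_abs]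

end Projection

/-! ### Symmetries and covariance of the uniform distribution on the sphere. -/

section Sphere

variable {m : ℕ}

lemma isProbabilityMeasure_uniformSphere (hm : 1 ≤ m) :
    IsProbabilityMeasure (uniformSphere m) := by
  have : Nonempty (Fin m) := ⟨⟨0, hm⟩⟩
  constructor
  rw [uniformSphere, Measure.map_apply measurable_subtype_coe MeasurableSet.univ]
  simp only [Set.preimage_univ, Measure.smul_apply, smul_eq_mul]
  refine ENNReal.inv_mul_cancel ?_ (measure_ne_top _ _)
  rw [Measure.measure_univ_ne_zero]
  exact Measure.toSphere_ne_zero _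

lemma ae_norm_eq_one_uniformSphere : ∀ᵐ v ∂(uniformSphere m), ‖v‖ = 1 := by
  rw [uniformSphere, ae_map_iff measurable_subtype_coe.aemeasurable
    (measurableSet_eq_fun measurable_norm measurable_const)]
  exact Filter.Eventually.of_forall fun v => by simp

/-- The measure of a part of the sphere is proportional to the volume of the cone over it, and an
isometry carries cones to cones and preserves volume. -/
lemma map_uniformSphere (e : Vec m ≃ₗᵢ[ℝ] Vec m) :
    (uniformSphere m).map e = uniformSphere m := by
  ext s hs
  have he : Measurable e := e.continuous.measurable
  rw [Measure.map_apply he hs, uniformSphere,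
    Measure.map_apply measurable_subtype_coe (he hs), Measure.map_apply measurable_subtype_coe hs]
  simp only [Measure.smul_apply]
  congr 1
  rw [Measure.toSphere_apply' _ (measurable_subtype_coe (he hs)),
    Measure.toSphere_apply' _ (measurable_subtype_coe hs)]
  congr 1
  rw [Subtype.image_preimage_coe, Subtype.image_preimage_coe]
  conv_rhs => rw [← e.measurePreserving.measure_preimage_emb e.toHomeomorph.measurableEmbedding]
  congr 1
  ext x
  simp only [Set.mem_smul, Set.mem_inter_iff, mem_sphere_zero_iff_norm, Set.mem_preimage]
  constructor
  · rintro ⟨r, hr, y, ⟨hy1, hy2⟩, rfl⟩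
    exact ⟨r, hr, e y, ⟨by simpa using hy1, hy2⟩, by simp⟩
  · rintro ⟨r, hr, y, ⟨hy1, hy2⟩, h⟩
    refine ⟨r, hr, e.symm y, ⟨by simpa using hy1, by simpa using hy2⟩, ?_⟩
    rw [← map_smul, h]; simp

lemma integral_comp_uniformSphere (e : Vec m ≃ₗᵢ[ℝ] Vec m) (f : Vec m → ℝ) :
    ∫ v, f (e v) ∂(uniformSphere m) = ∫ v, f v ∂(uniformSphere m) := by
  conv_rhs => rw [← map_uniformSphere e]
  exact (e.toHomeomorph.measurableEmbedding.integral_map _).symm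

lemma abs_coord_le_norm (v : Vec m) (a : Fin m) : |v a| ≤ ‖v‖ := PiLp.norm_apply_le v a

lemma integrable_coord_mul_coord (hm : 1 ≤ m) (a b : Fin m) :
    Integrable (fun v : Vec m => v a * v b) (uniformSphere m) := by
  have := isProbabilityMeasure_uniformSphere hm
  refine Integrable.of_bound (C := 1) (by fun_prop) ?_
  filter_upwards [ae_norm_eq_one_uniformSphere] with v hv
  rw [norm_mul]
  exact mul_le_one₀ ((abs_coord_le_norm v a).trans hv.le) (norm_nonneg _)
    ((abs_coord_le_norm v b).trans hv.le)

/-- The covariance of the uniform distribution on the unit sphere. -/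
lemma integral_coord_mul_coord (hm : 1 ≤ m) (a b : Fin m) :
    ∫ v, v a * v b ∂(uniformSphere m) = if a = b then 1 / (m : ℝ) else 0 := by
  have := isProbabilityMeasure_uniformSphere hm
  split_ifs with hab
  · subst hab
    -- Swapping coordinates makes all second moments equal; they add up to `1`.
    have hswap : ∀ b : Fin m, ∫ v, v b * v b ∂(uniformSphere m)
        = ∫ v, v a * v a ∂(uniformSphere m) := by
      intro b
      rw [← integral_comp_uniformSphere
        (LinearIsometryEquiv.piLpCongrLeft 2 ℝ ℝ (Equiv.swap a b)) (fun v => v a * v a)]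
      simp [LinearIsometryEquiv.piLpCongrLeft_apply, Equiv.piCongrLeft']
    have hsum : ∑ b : Fin m, ∫ v, v b * v b ∂(uniformSphere m) = 1 := by
      rw [← integral_finsetSum _ fun b _ => integrable_coord_mul_coord hm b b]
      have : ∀ᵐ v ∂(uniformSphere m), ∑ b, v b * v b = 1 := by
        filter_upwards [ae_norm_eq_one_uniformSphere] with v hv
        have h := EuclideanSpace.norm_sq_eq v
        rw [hv] at h
        simp only [Real.norm_eq_abs, sq_abs] at h
        simp only [← sq, ← h, one_pow]
      rw [integral_congr_ae this]
      simp
    simp only [hswap, Finset.sum_const, Finset.card_univ, Fintype.card_fin, nsmul_eq_mul] at hsum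
    rw [eq_div_iff (by positivity), mul_comm]
    exact hsum
  -- Reflecting coordinate `a` changes the sign of the mixed moment.
  · let e : Vec m ≃ₗᵢ[ℝ] Vec m := LinearIsometryEquiv.piLpCongrRight 2 fun i =>
      if i = a then LinearIsometryEquiv.neg ℝ else LinearIsometryEquiv.refl ℝ ℝ
    have h := integral_comp_uniformSphere e (fun v => v a * v b)
    have h2 : ∀ v, e v a * e v b = -(v a * v b) := by
      intro v
      simp [e, Ne.symm hab]
    simp only [h2, integral_neg] at h
    linarith

end Sphere

/-! ### The square loss and its two-point gradient estimate. -/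

section Loss

variable {m : ℕ}

/-- The gradient of the square loss. -/
noncomputable def lossGrad (h : Vec m) (z : ℝ) (y : Vec m) : Vec m := (inner ℝ h y - z) • h

/-- Symmetric differences of a quadratic are exact, so the query radius cancels and causes no bias.
-/
lemma gradEst_loss {ε : ℝ} (hε : ε ≠ 0) (h : Vec m) (z : ℝ) (u y : Vec m) :
    gradEst ε (loss h z) u y = ((m : ℝ) * (inner ℝ h y - z) * inner ℝ h u) • u := by
  rw [gradEst]
  congr 1
  simp only [loss, inner_add_right, inner_sub_right, real_inner_smul_right]
  field_simp
  ring

lemma loss_sub_le_inner (h : Vec m) (z : ℝ) (x y : Vec m) :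
    loss h z x - loss h z y ≤ inner ℝ (lossGrad h z x) (x - y) := by
  simp only [loss, lossGrad, real_inner_smul_left, inner_sub_right]
  nlinarith [sq_nonneg (inner ℝ h x - inner ℝ h y)]

variable {h : Vec m} {z α_h α_z ρ : ℝ}

lemma abs_residual_le (hh : ‖h‖ ^ 2 ≤ α_h) (hz : |z| ≤ α_z) {x : Vec m} (hx : ‖x‖ ≤ ρ) :
    |inner ℝ h x - z| ≤ Real.sqrt α_h * ρ + α_z := by
  have h1 : ‖h‖ ≤ Real.sqrt α_h := Real.le_sqrt_of_sq_le hh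
  have h2 : |inner ℝ h x| ≤ Real.sqrt α_h * ρ :=
    (abs_real_inner_le_norm h x).trans
      (mul_le_mul h1 hx (norm_nonneg _) (Real.sqrt_nonneg _))
  exact (abs_sub _ _).trans (add_le_add h2 hz)

/-- For `ρ = R` the bound is the constant `L` of the theorem. -/
lemma norm_lossGrad_le (hh : ‖h‖ ^ 2 ≤ α_h) (hz : |z| ≤ α_z) {x : Vec m} (hx : ‖x‖ ≤ ρ) :
    ‖lossGrad h z x‖ ≤ α_h * ρ + Real.sqrt α_h * α_z := by
  have h1 : ‖h‖ ≤ Real.sqrt α_h := Real.le_sqrt_of_sq_le hh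
  have h2 := abs_residual_le hh hz hx
  have h0 : 0 ≤ α_h := (sq_nonneg _).trans hh
  rw [lossGrad, norm_smul, Real.norm_eq_abs]
  refine (mul_le_mul h2 h1 (norm_nonneg _) ((abs_nonneg _).trans h2)).trans_eq ?_
  have := Real.mul_self_sqrt h0
  linear_combination ρ * this

lemma loss_sub_le_norm (hh : ‖h‖ ^ 2 ≤ α_h) (hz : |z| ≤ α_z) {x y : Vec m} (hx : ‖x‖ ≤ ρ) :
    loss h z x - loss h z y ≤ (α_h * ρ + Real.sqrt α_h * α_z) * ‖x - y‖ :=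
  (loss_sub_le_inner h z x y).trans ((real_inner_le_norm _ _).trans
    (mul_le_mul_of_nonneg_right (norm_lossGrad_le hh hz hx) (norm_nonneg _)))

lemma norm_gradEst_loss_le {ε : ℝ} (hε : ε ≠ 0) (hh : ‖h‖ ^ 2 ≤ α_h) (hz : |z| ≤ α_z)
    {x u : Vec m} (hx : ‖x‖ ≤ ρ) (hu : ‖u‖ = 1) :
    ‖gradEst ε (loss h z) u x‖ ≤ m * (α_h * ρ + Real.sqrt α_h * α_z) := by
  have h2 := norm_lossGrad_le hh hz hx
  have h3 : |inner ℝ h u| ≤ ‖h‖ := by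
    have := abs_real_inner_le_norm h u
    rwa [hu, mul_one] at this
  rw [lossGrad, norm_smul, Real.norm_eq_abs] at h2
  rw [gradEst_loss hε, norm_smul, hu, mul_one, Real.norm_eq_abs, abs_mul, abs_mul, Nat.abs_cast,
    mul_assoc]
  refine mul_le_mul_of_nonneg_left (le_trans ?_ h2) (Nat.cast_nonneg m)
  exact mul_le_mul_of_nonneg_left h3 (abs_nonneg _)

end Loss

/-! ### The quadratic penalty and the one-step inequality. -/

section Penalty

variable {m s : ℕ}

/-- The gradient of half the sum of the squared constraint violations. -/
noncomputable def penalty (k : Fin s → Vec m) (x : Vec m) : Vec m := ∑ q, viol (k q) x • k q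

/-- The sum of the squared constraint violations. -/
noncomputable def violSq (k : Fin s → Vec m) (x : Vec m) : ℝ := ∑ q, viol (k q) x ^ 2

lemma viol_nonneg (k x : Vec m) : 0 ≤ viol k x := le_max_left _ _

lemma violSq_nonneg (k : Fin s → Vec m) (x : Vec m) : 0 ≤ violSq k x :=
  Finset.sum_nonneg fun _ _ => sq_nonneg _

lemma viol_smul_violGrad (k x : Vec m) : viol k x • violGrad k x = viol k x • k := by
  rw [violGrad]
  split_ifs with h
  · rfl
  · rw [viol, max_eq_left (not_lt.1 h), zero_smul, zero_smul]

lemma sum_smul_violGrad (k : Fin s → Vec m) (reg : ℝ) (x : Vec m) :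
    ∑ q, (viol (k q) x / reg) • violGrad (k q) x = reg⁻¹ • penalty k x := by
  rw [penalty, Finset.smul_sum]
  refine Finset.sum_congr rfl fun q _ => ?_
  rw [div_eq_inv_mul, mul_smul, viol_smul_violGrad]

lemma viol_mul_inner (k x : Vec m) : viol k x * inner ℝ k x = viol k x ^ 2 := by
  rw [viol]
  rcases le_total (inner ℝ k x) 0 with h | h
  · rw [max_eq_left h]; ring
  · rw [max_eq_right h]; ring

lemma viol_le {K ρ : ℝ} {k x : Vec m} (hk : ‖k‖ ≤ K) (hx : ‖x‖ ≤ ρ) : viol k x ≤ K * ρ := by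
  have hK := (norm_nonneg k).trans hk
  have hρ := (norm_nonneg x).trans hx
  refine max_le (mul_nonneg hK hρ) ((real_inner_le_norm k x).trans ?_)
  exact mul_le_mul hk hx (norm_nonneg _) hK

lemma violSq_le_inner_penalty (k : Fin s → Vec m) (x : Vec m) {y : Vec m}
    (hy : ∀ q, inner ℝ (k q) y ≤ 0) : violSq k x ≤ inner ℝ (penalty k x) (x - y) := by
  rw [penalty, sum_inner, violSq]
  refine Finset.sum_le_sum fun q _ => ?_
  rw [real_inner_smul_left, inner_sub_right, mul_sub, viol_mul_inner]
  have := mul_nonneg (viol_nonneg (k q) x) (neg_nonneg.2 (hy q))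
  linarith

/-- Cauchy-Schwarz over the `s` constraints; this is the origin of the factor `s * K ^ 2` in the
step size. -/
lemma norm_penalty_sq_le {K : ℝ} {k : Fin s → Vec m} (hk : ∀ q, ‖k q‖ ≤ K) (x : Vec m) :
    ‖penalty k x‖ ^ 2 ≤ s * K ^ 2 * violSq k x := by
  have h1 : ‖penalty k x‖ ≤ ∑ q, viol (k q) x * K := by
    refine (norm_sum_le _ _).trans (Finset.sum_le_sum fun q _ => ?_)
    rw [norm_smul, Real.norm_of_nonneg (viol_nonneg _ _)]
    exact mul_le_mul_of_nonneg_left (hk q) (viol_nonneg _ _)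
  have h2 := sq_sum_le_card_mul_sum_sq (s := (Finset.univ : Finset (Fin s)))
    (f := fun q => viol (k q) x * K)
  simp only [mul_pow, ← Finset.sum_mul, Finset.card_univ, Fintype.card_fin] at h1 h2
  calc ‖penalty k x‖ ^ 2 ≤ ((∑ q, viol (k q) x) * K) ^ 2 := pow_le_pow_left₀ (norm_nonneg _) h1 2
    _ ≤ s * (violSq k x * K ^ 2) := by rw [mul_pow]; exact h2
    _ = _ := by ring

/-- A primal gradient step with a short enough penalty step decreases the distance to the
feasible points, up to the contribution of the loss. -/
lemma norm_step_sub_sq_le {K c η τ : ℝ} {k : Fin s → Vec m} (hk : ∀ q, ‖k q‖ ≤ K) (hc : 1 < c)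
    (hη : 0 ≤ η) (hητ : η * τ * (s * K ^ 2) * c = 1) (hτ : 0 ≤ τ)
    (x g : Vec m) {y : Vec m} (hy : ∀ q, inner ℝ (k q) y ≤ 0) :
    ‖x - η • (g + τ • penalty k x) - y‖ ^ 2 ≤
      ‖x - y‖ ^ 2 - 2 * η * inner ℝ g (x - y) - η * τ * violSq k x
        + c / (c - 1) * η ^ 2 * ‖g‖ ^ 2 := by
  set a := penalty k x with ha
  have hc1 : 0 < c - 1 := sub_pos.2 hc
  have h1 : ‖x - η • (g + τ • a) - y‖ ^ 2 = ‖x - y‖ ^ 2 - 2 * η * inner ℝ g (x - y)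
      - 2 * η * τ * inner ℝ a (x - y)
      + η ^ 2 * (‖g‖ ^ 2 + 2 * (τ * inner ℝ g a) + τ ^ 2 * ‖a‖ ^ 2) := by
    have e : x - η • (g + τ • a) - y = (x - y) - η • (g + τ • a) := by abel
    rw [e, norm_sub_sq_real, norm_smul, mul_pow, Real.norm_eq_abs, sq_abs, norm_add_sq_real,
      norm_smul, mul_pow, Real.norm_eq_abs, sq_abs, real_inner_smul_right, real_inner_smul_right,
      real_inner_comm, inner_add_left, real_inner_smul_left]
    ring
  -- The weight `c - 1` brings the total coefficient of the squared penalty to `c`, which the step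
  -- size just allows.
  have h2 : 2 * (τ * inner ℝ g a) ≤ 1 / (c - 1) * ‖g‖ ^ 2 + (c - 1) * (τ ^ 2 * ‖a‖ ^ 2) := by
    have h3 : inner ℝ g a ≤ ‖g‖ * ‖a‖ := real_inner_le_norm g a
    have h4 : 2 * (‖g‖ * (τ * ‖a‖)) ≤ 1 / (c - 1) * ‖g‖ ^ 2 + (c - 1) * (τ * ‖a‖) ^ 2 := by
      have : 1 / (c - 1) * ‖g‖ ^ 2 + (c - 1) * (τ * ‖a‖) ^ 2 - 2 * (‖g‖ * (τ * ‖a‖))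
          = 1 / (c - 1) * (‖g‖ - (c - 1) * (τ * ‖a‖)) ^ 2 := by
        field_simp
        ring
      have h5 : 0 ≤ 1 / (c - 1) * (‖g‖ - (c - 1) * (τ * ‖a‖)) ^ 2 := by positivity
      linarith
    have := mul_le_mul_of_nonneg_left h3 hτ
    nlinarith
  have h3 := violSq_le_inner_penalty k x hy
  have h4 := norm_penalty_sq_le hk x
  rw [← ha] at h3 h4
  -- This uses up one of the two copies of `η * τ * violSq k x` gained from the cross term; the
  -- other copy survives in the conclusion.
  have h5 : η ^ 2 * (c * (τ ^ 2 * ‖a‖ ^ 2)) ≤ η * τ * violSq k x := by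
    have : η ^ 2 * c * τ ^ 2 * ‖a‖ ^ 2 ≤ η ^ 2 * c * τ ^ 2 * (s * K ^ 2 * violSq k x) :=
      mul_le_mul_of_nonneg_left h4 (by positivity)
    calc _ = η ^ 2 * c * τ ^ 2 * ‖a‖ ^ 2 := by ring
      _ ≤ _ := this
      _ = (η * τ * (s * K ^ 2) * c) * (η * τ * violSq k x) := by ring
      _ = _ := by rw [hητ, one_mul]
  have h6 : c / (c - 1) = 1 + 1 / (c - 1) := by field_simp; ring
  have h7 := mul_le_mul_of_nonneg_left h2 (sq_nonneg η)
  have h8 := mul_le_mul_of_nonneg_left h3 (mul_nonneg hη hτ)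
  rw [h1, h6]
  nlinarith

end Penalty

/-! ### Disagreement between the nodes. -/

section Dispersion

variable {n m : ℕ}

/-- The Euclidean norm of a family of vectors. -/
noncomputable def stackNorm (v : Fin n → Vec m) : ℝ := Real.sqrt (∑ i, ‖v i‖ ^ 2)

/-- The Euclidean norm of the deviations of a family of vectors from their mean. -/
noncomputable def dispersion (v : Fin n → Vec m) : ℝ :=
  stackNorm fun i => v i - ∑ j, (n : ℝ)⁻¹ • v j

lemma stackNorm_eq (v : Fin n → Vec m) :
    stackNorm v = ‖(WithLp.toLp 2 v : PiLp 2 fun _ : Fin n => Vec m)‖ := by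
  rw [stackNorm, PiLp.norm_eq_of_L2]

lemma stackNorm_nonneg (v : Fin n → Vec m) : 0 ≤ stackNorm v := Real.sqrt_nonneg _

lemma stackNorm_sq (v : Fin n → Vec m) : stackNorm v ^ 2 = ∑ i, ‖v i‖ ^ 2 :=
  Real.sq_sqrt (Finset.sum_nonneg fun _ _ => sq_nonneg _)

lemma stackNorm_add_le (v w : Fin n → Vec m) :
    stackNorm (fun i => v i + w i) ≤ stackNorm v + stackNorm w := by
  simp only [stackNorm_eq]
  exact norm_add_le (WithLp.toLp 2 v : PiLp 2 fun _ : Fin n => Vec m) (WithLp.toLp 2 w)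

lemma stackNorm_smul (a : ℝ) (v : Fin n → Vec m) :
    stackNorm (fun i => a • v i) = |a| * stackNorm v := by
  simp only [stackNorm_eq]
  exact norm_smul a (WithLp.toLp 2 v : PiLp 2 fun _ : Fin n => Vec m)

lemma stackNorm_le_of_norm_le {v : Fin n → Vec m} {ρ : ℝ} (hρ : 0 ≤ ρ) (hv : ∀ i, ‖v i‖ ≤ ρ) :
    stackNorm v ≤ Real.sqrt n * ρ := by
  refine le_of_sq_le_sq ?_ (by positivity)
  rw [stackNorm_sq, mul_pow, Real.sq_sqrt (Nat.cast_nonneg n)]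
  calc _ ≤ ∑ _i : Fin n, ρ ^ 2 :=
        Finset.sum_le_sum fun i _ => pow_le_pow_left₀ (norm_nonneg _) (hv i) 2
    _ = _ := by simp

lemma stackNorm_mono {v w : Fin n → Vec m} (h : ∀ i, ‖v i‖ ≤ ‖w i‖) :
    stackNorm v ≤ stackNorm w :=
  Real.sqrt_le_sqrt (Finset.sum_le_sum fun i _ => pow_le_pow_left₀ (norm_nonneg _) (h i) 2)

lemma norm_le_stackNorm (v : Fin n → Vec m) (i : Fin n) : ‖v i‖ ≤ stackNorm v := by
  rw [stackNorm_eq]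
  exact PiLp.norm_apply_le (WithLp.toLp 2 v : PiLp 2 fun _ : Fin n => Vec m) i

/-- The mean minimizes the sum of squared distances. -/
lemma dispersion_le_stackNorm_sub (hn : 0 < n) (v : Fin n → Vec m) (a : Vec m) :
    dispersion v ≤ stackNorm fun i => v i - a := by
  have hn' : (n : ℝ) ≠ 0 := by positivity
  refine le_of_sq_le_sq ?_ (stackNorm_nonneg _)
  rw [dispersion, stackNorm_sq, stackNorm_sq]
  have h := sum_weighted_norm_sub_sq (fun _ : Fin n => (n : ℝ)⁻¹) (by simp [hn'])
    (fun i => v i - a)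
  have e : ∑ l, (n : ℝ)⁻¹ • (v l - a) = ∑ l, (n : ℝ)⁻¹ • v l - a := by
    simp only [smul_sub, Finset.sum_sub_distrib, Finset.sum_const, Finset.card_univ,
      Fintype.card_fin]
    rw [← Nat.cast_smul_eq_nsmul ℝ, smul_smul, mul_inv_cancel₀ hn', one_smul]
  simp only [e, sub_sub_sub_cancel_right, ← Finset.mul_sum] at h
  have h0 : 0 ≤ (n : ℝ) * ‖∑ l, (n : ℝ)⁻¹ • v l - a‖ ^ 2 := by positivity
  have h' := congrArg ((n : ℝ) * ·) h
  simp only [mul_sub, mul_inv_cancel_left₀ hn'] at h'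
  linarith

lemma dispersion_nonneg (v : Fin n → Vec m) : 0 ≤ dispersion v := stackNorm_nonneg _

lemma sum_norm_sub_le_dispersion (v : Fin n → Vec m) (i : Fin n) :
    ∑ j, ‖v i - v j‖ ≤ 2 * n * dispersion v := by
  have h : ∀ j, ‖v i - v j‖ ≤ 2 * dispersion v := by
    intro j
    have h1 : ∀ i, ‖v i - ∑ j, (n : ℝ)⁻¹ • v j‖ ≤ dispersion v := norm_le_stackNorm _
    have h2 := norm_sub_le_norm_sub_add_norm_sub (v i) (∑ j, (n : ℝ)⁻¹ • v j) (v j)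
    rw [norm_sub_rev (∑ l, (n : ℝ)⁻¹ • v l)] at h2
    have h3 := h1 i
    have h4 := h1 j
    linarith
  calc _ ≤ ∑ _j : Fin n, 2 * dispersion v := Finset.sum_le_sum fun j _ => h j
    _ = _ := by simp; ring

variable {G : Digraph (Fin n)} {W : Matrix (Fin n) (Fin n) ℝ}

lemma IsNetwork.stackNorm_average_le (hW : IsNetwork G W) (v : Fin n → Vec m) :
    stackNorm (fun i => ∑ j, W i j • v j) ≤ stackNorm v :=
  Real.sqrt_le_sqrt (hW.sum_norm_sq_average_le v)

/-- Dispersion after one perturbed averaging step. -/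
lemma IsNetwork.dispersion_le (hn : 0 < n) (hW : IsNetwork G W) (hs : sigma2 W < 1)
    (v v' : Fin n → Vec m) :
    dispersion v' ≤ sigma2 W * dispersion v + stackNorm fun i => v' i - ∑ j, W i j • v j := by
  set a := ∑ j, (n : ℝ)⁻¹ • v j with ha
  have hn' : (n : ℝ) ≠ 0 := by positivity
  refine (dispersion_le_stackNorm_sub hn v' a).trans ?_
  -- The deviations from the old mean have zero sum, so the spectral contraction applies to them.
  have h1 : stackNorm (fun i => ∑ j, W i j • (v j - a)) ≤ sigma2 W * dispersion v := by
    refine le_of_sq_le_sq ?_ (mul_nonneg (sigma2_nonneg W) (dispersion_nonneg v))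
    rw [mul_pow, dispersion, stackNorm_sq, stackNorm_sq]
    refine hW.sum_norm_sq_average_le_sigma2 hs _ ?_
    rw [Finset.sum_sub_distrib, ha, ← Finset.smul_sum, Finset.sum_const, Finset.card_univ,
      Fintype.card_fin, ← Nat.cast_smul_eq_nsmul ℝ, smul_smul, mul_inv_cancel₀ hn', one_smul,
      sub_self]
  have h2 := stackNorm_add_le (fun i => ∑ j, W i j • (v j - a))
    (fun i => v' i - ∑ j, W i j • v j)
  have e : ∀ i, ∑ j, W i j • (v j - a) + (v' i - ∑ j, W i j • v j) = v' i - a := by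
    intro i
    simp only [smul_sub, Finset.sum_sub_distrib, ← Finset.sum_smul, hW.row_sum, one_smul]
    abel
  simp only [e] at h2
  linarith

end Dispersion

/-! ### Energy and disagreement along a deterministic trajectory. -/

section Trajectory

variable {n m s : ℕ} {G : Digraph (Fin n)} {W : Matrix (Fin n) (Fin n) ℝ} {k : Fin s → Vec m}
  {K c η τ r R e b : ℝ} {X g : ℕ → Fin n → Vec m}

/-- `X` is driven by the directions `g` through penalized gradient steps, averaging and
projection onto the ball of radius `r`. -/
def IsTrajectory (W : Matrix (Fin n) (Fin n) ℝ) (k : Fin s → Vec m) (η τ r : ℝ)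
    (X g : ℕ → Fin n → Vec m) : Prop :=
  ∀ t i, X (t + 1) i = proj (Metric.closedBall 0 r)
    (∑ j, W i j • (X t j - η • (g t j + τ • penalty k (X t j))))

lemma norm_proj_ball_sub_le (hr : 0 ≤ r) (v : Vec m) {y : Vec m} (hy : ‖y‖ ≤ r) :
    ‖proj (Metric.closedBall 0 r) v - y‖ ≤ ‖v - y‖ := by
  have hne : (Metric.closedBall (0 : Vec m) r).Nonempty := Metric.nonempty_closedBall.2 hr
  have hy' : y ∈ Metric.closedBall (0 : Vec m) r := by simpa using hy
  have := norm_proj_sub_proj_le hne Metric.isClosed_closedBall (convex_closedBall _ _) v y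
  rwa [proj_eq_self hne Metric.isClosed_closedBall (convex_closedBall _ _) hy'] at this

lemma norm_proj_ball_sub_self_le (hr : 0 ≤ r) (hrR : r ≤ R) {v : Vec m} (hv : ‖v‖ ≤ R) :
    ‖proj (Metric.closedBall 0 r) v - v‖ ≤ R - r := by
  have hne : (Metric.closedBall (0 : Vec m) r).Nonempty := Metric.nonempty_closedBall.2 hr
  rcases le_or_gt ‖v‖ r with h | h
  · rw [proj_eq_self hne Metric.isClosed_closedBall (convex_closedBall _ _) (by simpa using h)]
    simpa using hrR
  · have h0 : 0 < ‖v‖ := hr.trans_lt h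
    -- The radial rescaling of `v` serves as a competitor for the nearest point.
    have hw : (r / ‖v‖) • v ∈ Metric.closedBall (0 : Vec m) r := by
      rw [mem_closedBall_zero_iff, norm_smul, Real.norm_of_nonneg (by positivity),
        div_mul_cancel₀ _ h0.ne']
    have := (proj_spec hne Metric.isClosed_closedBall (convex_closedBall _ _) v).2 _ hw
    rw [norm_sub_rev]
    refine this.trans ?_
    have e1 : v - (r / ‖v‖) • v = (1 - r / ‖v‖) • v := by rw [sub_smul, one_smul]
    rw [e1, norm_smul, Real.norm_of_nonneg (sub_nonneg.2 ((div_le_one h0).2 h.le)), sub_mul,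
      div_mul_cancel₀ _ h0.ne', one_mul]
    linarith

/-- Neither projection nor doubly stochastic averaging increases the total squared distance to `y`,
so the one-step inequalities add up and telescope. -/
lemma IsTrajectory.sum_inner_le (hW : IsNetwork G W) (hX : IsTrajectory W k η τ r X g)
    (hk : ∀ q, ‖k q‖ ≤ K) (hc : 1 < c) (hη : 0 ≤ η) (hτ : 0 ≤ τ)
    (hητ : η * τ * (s * K ^ 2) * c = 1) (hr : 0 ≤ r) {y : Vec m} (hy : ‖y‖ ≤ r)
    (hky : ∀ q, inner ℝ (k q) y ≤ 0) (T : ℕ) :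
    2 * η * ∑ t ∈ Finset.range T, ∑ j, inner ℝ (g t j) (X t j - y)
      + η * τ * ∑ t ∈ Finset.range T, ∑ j, violSq k (X t j) + ∑ j, ‖X T j - y‖ ^ 2 ≤
    ∑ j, ‖X 0 j - y‖ ^ 2
      + c / (c - 1) * η ^ 2 * ∑ t ∈ Finset.range T, ∑ j, ‖g t j‖ ^ 2 := by
  induction T with
  | zero => simp
  | succ T ih =>
    simp only [Finset.sum_range_succ]
    have h1 : ∑ i, ‖X (T + 1) i - y‖ ^ 2 ≤
        ∑ j, ‖X T j - η • (g T j + τ • penalty k (X T j)) - y‖ ^ 2 := by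
      refine le_trans ?_ (hW.sum_norm_sq_average_le _)
      refine Finset.sum_le_sum fun i _ => pow_le_pow_left₀ (norm_nonneg _) ?_ 2
      rw [hX T i]
      refine (norm_proj_ball_sub_le hr _ hy).trans_eq ?_
      congr 1
      simp only [smul_sub _ _ y, Finset.sum_sub_distrib, ← Finset.sum_smul, hW.row_sum, one_smul]
    have h2 : ∑ j, ‖X T j - η • (g T j + τ • penalty k (X T j)) - y‖ ^ 2 ≤
        ∑ j, (‖X T j - y‖ ^ 2 - 2 * η * inner ℝ (g T j) (X T j - y)
          - η * τ * violSq k (X T j) + c / (c - 1) * η ^ 2 * ‖g T j‖ ^ 2) :=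
      Finset.sum_le_sum fun j _ => norm_step_sub_sq_le hk hc hη hητ hτ _ _ hky
    rw [Finset.sum_add_distrib, Finset.sum_sub_distrib, Finset.sum_sub_distrib, ← Finset.mul_sum,
      ← Finset.mul_sum, ← Finset.mul_sum] at h2
    linarith

/-- Insert the projection of the plain average. It differs from the new estimate by at most the
averaged gradient step, and from the plain average by at most `R - r`. -/
lemma IsTrajectory.stackNorm_sub_average_le (hW : IsNetwork G W)
    (hX : IsTrajectory W k η τ r X g) (hk : ∀ q, ‖k q‖ ≤ K) (hc : 1 < c) (hs : 1 ≤ s)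
    (hK : 0 < K) (hη : 0 ≤ η) (hτ : 0 ≤ τ) (hητ : η * τ * (s * K ^ 2) * c = 1)
    (hr : 0 ≤ r) (hrR : r ≤ R) (hXR : ∀ t i, ‖X t i‖ ≤ R) (t : ℕ) (hb : 0 ≤ b)
    (hg : ∀ j, ‖g t j‖ ≤ b) :
    stackNorm (fun i => X (t + 1) i - ∑ j, W i j • X t j) ≤
      Real.sqrt n * (η * b) + Real.sqrt (∑ j, violSq k (X t j)) / K + Real.sqrt n * (R - r) := by
  set a : Fin n → Vec m := fun i => ∑ j, W i j • X t j with ha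
  set p : Fin n → Vec m := fun j => g t j + τ • penalty k (X t j) with hp
  have haR : ∀ i, ‖a i‖ ≤ R := by
    intro i
    calc ‖a i‖ ≤ ∑ j, W i j * R := by
          refine (norm_sum_le _ _).trans (Finset.sum_le_sum fun j _ => ?_)
          rw [norm_smul, Real.norm_of_nonneg (hW.nonneg i j)]
          exact mul_le_mul_of_nonneg_left (hXR t j) (hW.nonneg i j)
      _ = R := by rw [← Finset.sum_mul, hW.row_sum, one_mul]
  have h1 : stackNorm (fun i => X (t + 1) i - a i) ≤
      stackNorm (fun i => X (t + 1) i - proj (Metric.closedBall 0 r) (a i))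
        + stackNorm (fun i => proj (Metric.closedBall 0 r) (a i) - a i) := by
    refine le_trans (le_of_eq ?_) (stackNorm_add_le _ _)
    simp only [sub_add_sub_cancel]
  have h2 : stackNorm (fun i => proj (Metric.closedBall 0 r) (a i) - a i) ≤
      Real.sqrt n * (R - r) :=
    stackNorm_le_of_norm_le (sub_nonneg.2 hrR) fun i =>
      norm_proj_ball_sub_self_le hr hrR (haR i)
  have h3 : stackNorm (fun i => X (t + 1) i - proj (Metric.closedBall 0 r) (a i)) ≤
      stackNorm (fun i => (-η) • ∑ j, W i j • p j) := by
    refine stackNorm_mono fun i => ?_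
    rw [hX t i]
    refine (norm_proj_sub_proj_le (Metric.nonempty_closedBall.2 hr) Metric.isClosed_closedBall
      (convex_closedBall _ _) _ _).trans_eq ?_
    congr 1
    simp only [ha, smul_sub, Finset.sum_sub_distrib, Finset.smul_sum, neg_smul,
      Finset.sum_neg_distrib]
    rw [sub_sub_cancel_left]
    simp only [smul_comm η]
    rfl
  have h4 : stackNorm p ≤ stackNorm (g t) + τ * stackNorm fun j => penalty k (X t j) := by
    have := stackNorm_add_le (g t) (fun j => τ • penalty k (X t j))
    rwa [stackNorm_smul, abs_of_nonneg hτ] at this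
  -- After squaring, the step-size identity is used twice: once with and once without the factor
  -- `s`.
  have h5 : η * τ * stackNorm (fun j => penalty k (X t j)) ≤
      Real.sqrt (∑ j, violSq k (X t j)) / K := by
    have hV : 0 ≤ ∑ j, violSq k (X t j) := Finset.sum_nonneg fun _ _ => violSq_nonneg _ _
    refine le_of_sq_le_sq ?_ (by positivity)
    rw [mul_pow, stackNorm_sq, div_pow, Real.sq_sqrt hV, le_div_iff₀ (by positivity)]
    have h6 : ∑ j, ‖penalty k (X t j)‖ ^ 2 ≤ s * K ^ 2 * ∑ j, violSq k (X t j) := by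
      rw [Finset.mul_sum]
      exact Finset.sum_le_sum fun j _ => norm_penalty_sq_le hk _
    have hs' : (1 : ℝ) ≤ s := by exact_mod_cast hs
    have h7 : η * τ * K ^ 2 ≤ 1 := by
      have h0 : 0 ≤ η * τ * K ^ 2 := by positivity
      have : η * τ * K ^ 2 * 1 ≤ η * τ * K ^ 2 * (s * c) :=
        mul_le_mul_of_nonneg_left (by nlinarith) h0
      linarith
    have h8 : η * τ * (s * K ^ 2) ≤ 1 := by
      have h0 : 0 ≤ η * τ * (s * K ^ 2) := by positivity
      nlinarith
    calc (η * τ) ^ 2 * (∑ j, ‖penalty k (X t j)‖ ^ 2) * K ^ 2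
        ≤ (η * τ) ^ 2 * (s * K ^ 2 * ∑ j, violSq k (X t j)) * K ^ 2 := by gcongr
      _ = (η * τ * K ^ 2) * (η * τ * (s * K ^ 2)) * ∑ j, violSq k (X t j) := by ring
      _ ≤ 1 * 1 * ∑ j, violSq k (X t j) := by gcongr
      _ = _ := by ring
  have h6 : stackNorm (g t) ≤ Real.sqrt n * b := stackNorm_le_of_norm_le hb hg
  rw [stackNorm_smul, abs_neg, abs_of_nonneg hη] at h3
  have h7 : η * stackNorm (fun i => ∑ j, W i j • p j) ≤ η * (Real.sqrt n * b)
      + η * τ * stackNorm (fun j => penalty k (X t j)) := by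
    have := mul_le_mul_of_nonneg_left (((hW.stackNorm_average_le p).trans h4).trans
      (add_le_add_left h6 _)) hη
    linarith
  linarith

lemma IsTrajectory.sum_dispersion_le (hn : 0 < n) (hW : IsNetwork G W) (hσ : sigma2 W < 1)
    (hX : IsTrajectory W k η τ r X g) (hk : ∀ q, ‖k q‖ ≤ K) (hc : 1 < c) (hs : 1 ≤ s)
    (hK : 0 < K) (hη : 0 ≤ η) (hτ : 0 ≤ τ) (hητ : η * τ * (s * K ^ 2) * c = 1)
    (hr : 0 ≤ r) (hrR : r ≤ R) (hXR : ∀ t i, ‖X t i‖ ≤ R) (hb : 0 ≤ b) {T : ℕ}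
    (hg : ∀ t < T, ∀ j, ‖g t j‖ ≤ b) :
    (1 - sigma2 W) * ∑ t ∈ Finset.range T, dispersion (X t) ≤
      Real.sqrt n * R + Real.sqrt n * (T * (η * b))
        + (∑ t ∈ Finset.range T, Real.sqrt (∑ j, violSq k (X t j))) / K
        + Real.sqrt n * (T * (R - r)) := by
  have h0 : dispersion (X 0) ≤ Real.sqrt n * R := by
    have := dispersion_le_stackNorm_sub hn (X 0) 0
    simp only [sub_zero] at this
    exact this.trans (stackNorm_le_of_norm_le (hr.trans hrR) (hXR 0))
  -- The extra last term closes the induction: the contraction turns it into the next summand plus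
  -- the next last term.
  have h : ∀ S ≤ T, (1 - sigma2 W) * ∑ t ∈ Finset.range S, dispersion (X t) + dispersion (X S) ≤
      Real.sqrt n * R + Real.sqrt n * (S * (η * b))
        + (∑ t ∈ Finset.range S, Real.sqrt (∑ j, violSq k (X t j))) / K
        + Real.sqrt n * (S * (R - r)) := by
    intro S hS
    induction S with
    | zero => simpa using h0
    | succ S ih =>
      have h1 := ih (by omega)
      have h2 := hW.dispersion_le hn hσ (X S) (X (S + 1))
      have h3 := hX.stackNorm_sub_average_le hW hk hc hs hK hη hτ hητ hr hrR hXR S hb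
        (hg S (by omega))
      rw [Finset.sum_range_succ, Finset.sum_range_succ, add_div]
      push_cast
      linarith
  have := h T le_rfl
  have := dispersion_nonneg (X T)
  linarith

end Trajectory

/-! ### Pathwise bounds up to the gradient noise. -/

section Bounds

/-- The constant in the regret bound. -/
noncomputable def regretConst (s : ℕ) (c δ : ℝ) : ℝ :=
  2 + 4 / δ ^ 2 + 3 / δ + 2 * c * s + c / (c - 1) / δ ^ 2

/-- The constant in the bound on the constraint violations. -/
noncomputable def violConst (s : ℕ) (c δ : ℝ) : ℝ :=
  2 / δ ^ 4 + 2 * c * s / δ ^ 2 + c / (c - 1) / δ ^ 6 + s / 2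

/-- To be read with `w = 1 / (1 - sigma2 W)`, `Q = T ^ (1 - β)`, `P = T ^ max β (1 - β)`, `q = n *
√n` and `p = n ^ (5 / 2)`. Each term is dominated by one monomial on the right; missing factors are
supplied by `R / δ` and by quantities at least `1`. -/
lemma regret_arith {s : ℕ} {c δ n m L R K w Q τ P p q : ℝ} (hc : 1 < c) (hδ : 0 < δ)
    (hn : 1 ≤ n) (hm : 1 ≤ m) (hL : δ ≤ L) (hR : δ ≤ R) (hw : 1 ≤ w) (hQ : 1 ≤ Q)
    (hQP : Q ≤ P) (hτ : 0 < τ) (hτP : τ ≤ P) (hq : 0 ≤ q) (hqp : q ≤ p) (hnp : n ≤ p) :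
    2 * q * w * L * R * Q + 2 * q * w * L * (Q / δ ^ 2 * (m * L)) + 2 * q * w * L * Q
      + 2 * n ^ 2 * L ^ 2 * w ^ 2 / δ ^ 2 * Q
      + (2 * c * s * n * K ^ 2 * R ^ 2 * τ + c / (c - 1) * (n * (m * L) ^ 2 * (Q / δ ^ 2)))
      + n * L * Q ≤
    regretConst s c δ * (w ^ 2 * (m ^ 2 * p * L ^ 2 + p * L * R + n ^ 4 * L ^ 2)
      + n * K ^ 2 * R ^ 2) * P := by
  have hc1 : 0 < c - 1 := sub_pos.2 hc
  have hL0 : 0 < L := hδ.trans_le hL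
  have hR0 : 0 < R := hδ.trans_le hR
  have hP0 : 0 < P := hτ.trans_le hτP
  have hp0 : 0 ≤ p := hq.trans hqp
  have hw2 : w ≤ w ^ 2 := by nlinarith
  have hw1 : 1 ≤ w ^ 2 := by nlinarith
  have hm2 : m ≤ m ^ 2 := by nlinarith
  have hn4 : n ^ 2 ≤ n ^ 4 := pow_le_pow_right₀ hn (by norm_num)
  have hRδ : 1 ≤ R / δ := (one_le_div hδ).2 hR
  have a1 : q * w * L * R * Q ≤ p * w ^ 2 * L * R * P := by gcongr
  have a2 : q * w * L * (Q / δ ^ 2 * (m * L)) ≤ p * w ^ 2 * L * (P / δ ^ 2 * (m ^ 2 * L)) := by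
    gcongr
  have a3 : q * w * L * Q ≤ p * w ^ 2 * L * (R / δ * P) := by
    calc q * w * L * Q = q * w * L * (1 * Q) := by ring
      _ ≤ _ := by gcongr
  have a4 : n ^ 2 * L ^ 2 * w ^ 2 / δ ^ 2 * Q ≤ n ^ 4 * L ^ 2 * w ^ 2 / δ ^ 2 * P := by gcongr
  have a5 : c * s * n * K ^ 2 * R ^ 2 * τ ≤ c * s * n * K ^ 2 * R ^ 2 * P := by gcongr
  have a6 : c / (c - 1) * (n * (m * L) ^ 2 * (Q / δ ^ 2)) ≤
      c / (c - 1) * (p * (m * L) ^ 2 * (P / δ ^ 2) * w ^ 2) := by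
    calc _ = c / (c - 1) * (n * (m * L) ^ 2 * (Q / δ ^ 2) * 1) := by ring
      _ ≤ _ := by gcongr
  have a7 : n * L * Q ≤ p * w ^ 2 * L * (R / δ * P) := by
    calc n * L * Q = n * 1 * L * (1 * Q) := by ring
      _ ≤ _ := by gcongr
  set X := w ^ 2 * (m ^ 2 * p * L ^ 2 + p * L * R + n ^ 4 * L ^ 2) + n * K ^ 2 * R ^ 2 with hX
  have hn0 : 0 ≤ n := zero_le_one.trans hn
  have t1 : 0 ≤ w ^ 2 * (m ^ 2 * p * L ^ 2) := by positivity
  have t2 : 0 ≤ w ^ 2 * (p * L * R) := by positivity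
  have t3 : 0 ≤ w ^ 2 * (n ^ 4 * L ^ 2) := by positivity
  have t4 : 0 ≤ n * K ^ 2 * R ^ 2 := by positivity
  have x1 : w ^ 2 * (m ^ 2 * p * L ^ 2) ≤ X := by rw [hX]; linarith
  have x2 : w ^ 2 * (p * L * R) ≤ X := by rw [hX]; linarith
  have x3 : w ^ 2 * (n ^ 4 * L ^ 2) ≤ X := by rw [hX]; linarith
  have x4 : n * K ^ 2 * R ^ 2 ≤ X := by rw [hX]; linarith
  have b1 : p * w ^ 2 * L * R * P ≤ X * P := by
    calc _ = w ^ 2 * (p * L * R) * P := by ring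
      _ ≤ _ := by gcongr
  have b2 : p * w ^ 2 * L * (P / δ ^ 2 * (m ^ 2 * L)) ≤ 1 / δ ^ 2 * (X * P) := by
    calc _ = 1 / δ ^ 2 * (w ^ 2 * (m ^ 2 * p * L ^ 2) * P) := by ring
      _ ≤ _ := by gcongr
  have b3 : p * w ^ 2 * L * (R / δ * P) ≤ 1 / δ * (X * P) := by
    calc _ = 1 / δ * (w ^ 2 * (p * L * R) * P) := by ring
      _ ≤ _ := by gcongr
  have b4 : n ^ 4 * L ^ 2 * w ^ 2 / δ ^ 2 * P ≤ 1 / δ ^ 2 * (X * P) := by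
    calc _ = 1 / δ ^ 2 * (w ^ 2 * (n ^ 4 * L ^ 2) * P) := by ring
      _ ≤ _ := by gcongr
  have b5 : c * s * n * K ^ 2 * R ^ 2 * P ≤ c * s * (X * P) := by
    calc _ = c * s * (n * K ^ 2 * R ^ 2 * P) := by ring
      _ ≤ _ := by gcongr
  have b6 : c / (c - 1) * (p * (m * L) ^ 2 * (P / δ ^ 2) * w ^ 2) ≤
      c / (c - 1) / δ ^ 2 * (X * P) := by
    calc _ = c / (c - 1) / δ ^ 2 * (w ^ 2 * (m ^ 2 * p * L ^ 2) * P) := by ring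
      _ ≤ _ := by gcongr
  have e : regretConst s c δ * X * P = 2 * (X * P) + 4 * (1 / δ ^ 2 * (X * P))
      + 3 * (1 / δ * (X * P)) + 2 * (c * s * (X * P)) + c / (c - 1) / δ ^ 2 * (X * P) := by
    rw [regretConst]; ring
  rw [e]
  calc _ = 2 * (q * w * L * R * Q) + 2 * (q * w * L * (Q / δ ^ 2 * (m * L)))
        + 2 * (q * w * L * Q) + 2 * (n ^ 2 * L ^ 2 * w ^ 2 / δ ^ 2 * Q)
        + 2 * (c * s * n * K ^ 2 * R ^ 2 * τ) + c / (c - 1) * (n * (m * L) ^ 2 * (Q / δ ^ 2))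
        + n * L * Q := by ring
    _ ≤ _ := by linarith

lemma viol_arith {s : ℕ} {c δ m L R K : ℝ} (hc : 1 < c) (hδ : 0 < δ)
    (hm : 1 ≤ m) (hL : δ ≤ L) (hR : δ ≤ R) (hK : δ ≤ K) :
    (2 * L * R + 2 * c * s * K ^ 2 * R ^ 2 + c / (c - 1) * ((m * L) ^ 2 / δ ^ 2))
        / (m * L * K * R) + s * (m * L * K * R) / 2 ≤ violConst s c δ * (m * L * K * R) := by
  have hc1 : 0 < c - 1 := sub_pos.2 hc
  have hL0 : 0 < L := hδ.trans_le hL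
  have hR0 : 0 < R := hδ.trans_le hR
  have hK0 : 0 < K := hδ.trans_le hK
  have hm0 : 0 < m := one_pos.trans_le hm
  set Z := m * L * K * R with hZ
  have hZ0 : 0 < Z := by positivity
  have a1 : L * R ≤ 1 / δ ^ 4 * Z ^ 2 := by
    rw [one_div, ← div_eq_inv_mul, le_div_iff₀ (by positivity)]
    calc L * R * δ ^ 4 = (L * R) * (δ * δ * δ ^ 2) := by ring
      _ ≤ (L * R) * ((m * L) * (m * R) * K ^ 2) := by
        gcongr
        · exact hL.trans (le_mul_of_one_le_left hL0.le hm)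
        · exact hR.trans (le_mul_of_one_le_left hR0.le hm)
      _ = Z ^ 2 := by rw [hZ]; ring
  have a2 : K ^ 2 * R ^ 2 ≤ 1 / δ ^ 2 * Z ^ 2 := by
    rw [one_div, ← div_eq_inv_mul, le_div_iff₀ (by positivity)]
    calc K ^ 2 * R ^ 2 * δ ^ 2 ≤ K ^ 2 * R ^ 2 * (m * L) ^ 2 := by
          gcongr
          exact hL.trans (le_mul_of_one_le_left hL0.le hm)
      _ = Z ^ 2 := by rw [hZ]; ring
  have a3 : (m * L) ^ 2 / δ ^ 2 ≤ 1 / δ ^ 6 * Z ^ 2 := by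
    have h1 : 1 / δ ^ 6 * Z ^ 2 = (Z ^ 2 / δ ^ 4) / δ ^ 2 := by field_simp
    rw [h1]
    gcongr
    rw [le_div_iff₀ (by positivity)]
    calc (m * L) ^ 2 * δ ^ 4 = (m * L) ^ 2 * (δ ^ 2 * δ ^ 2) := by ring
      _ ≤ (m * L) ^ 2 * (K ^ 2 * R ^ 2) := by gcongr
      _ = Z ^ 2 := by rw [hZ]; ring
  have h1 : (2 * L * R + 2 * c * s * K ^ 2 * R ^ 2 + c / (c - 1) * ((m * L) ^ 2 / δ ^ 2)) / Z
      ≤ (2 / δ ^ 4 + 2 * c * s / δ ^ 2 + c / (c - 1) / δ ^ 6) * Z := by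
    rw [div_le_iff₀ hZ0]
    have b2 : c * s * (K ^ 2 * R ^ 2) ≤ c * s * (1 / δ ^ 2 * Z ^ 2) := by gcongr
    have b3 : c / (c - 1) * ((m * L) ^ 2 / δ ^ 2) ≤ c / (c - 1) * (1 / δ ^ 6 * Z ^ 2) := by gcongr
    calc _ = 2 * (L * R) + 2 * (c * s * (K ^ 2 * R ^ 2))
          + c / (c - 1) * ((m * L) ^ 2 / δ ^ 2) := by ring
      _ ≤ 2 * (1 / δ ^ 4 * Z ^ 2) + 2 * (c * s * (1 / δ ^ 2 * Z ^ 2))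
          + c / (c - 1) * (1 / δ ^ 6 * Z ^ 2) := by linarith
      _ = _ := by ring
  rw [violConst]
  linarith

variable {n m s : ℕ} {G : Digraph (Fin n)} {W : Matrix (Fin n) (Fin n) ℝ} {k : Fin s → Vec m}
  {K c η τ r R δ Q L α_h α_z : ℝ} {X g : ℕ → Fin n → Vec m} {T : ℕ}
  {h : ℕ → Fin n → Vec m} {z : ℕ → Fin n → ℝ} {y : Vec m}

/-- The accumulated effect of the errors of the gradient estimates. -/
noncomputable def noise (T : ℕ) (h : ℕ → Fin n → Vec m) (z : ℕ → Fin n → ℝ)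
    (X g : ℕ → Fin n → Vec m) (y : Vec m) : ℝ :=
  ∑ t ∈ Finset.range T, ∑ j, inner ℝ (g t j - lossGrad (h t j) (z t j) (X t j)) (X t j - y)

lemma noise_eq (T : ℕ) (h : ℕ → Fin n → Vec m) (z : ℕ → Fin n → ℝ)
    (X g : ℕ → Fin n → Vec m) (y : Vec m) :
    noise T h z X g y = ∑ t ∈ Finset.range T, ∑ j, inner ℝ (g t j) (X t j - y)
      - ∑ t ∈ Finset.range T, ∑ j, inner ℝ (lossGrad (h t j) (z t j) (X t j)) (X t j - y) := by
  simp only [noise, inner_sub_left (g _ _), Finset.sum_sub_distrib]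

lemma sum_const_rounds (T n : ℕ) (a : ℝ) :
    ∑ _t ∈ Finset.range T, ∑ _j : Fin n, a = n * T * a := by
  simp; ring

/-- Pass from the estimate of node `i` to that of node `j`, then to `y`, then to `ystar`. Convexity
handles the middle step, Lipschitz bounds the other two. -/
lemma totalLoss_sub_le {ystar : Vec m} (hL : L = α_h * R + Real.sqrt α_h * α_z)
    (hdata : ∀ t < T, ∀ j, ‖h t j‖ ^ 2 ≤ α_h ∧ |z t j| ≤ α_z) (hXR : ∀ t i, ‖X t i‖ ≤ R)
    (hy : ‖y‖ ≤ R) (hL0 : 0 ≤ L) (i : Fin n) :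
    totalLoss T h z (fun t => X t i) - totalLoss T h z (fun _ => ystar) ≤
      L * (2 * n) * ∑ t ∈ Finset.range T, dispersion (X t)
        + ∑ t ∈ Finset.range T, ∑ j, inner ℝ (lossGrad (h t j) (z t j) (X t j)) (X t j - y)
        + n * T * (L * ‖y - ystar‖) := by
  rw [totalLoss, totalLoss, ← Finset.sum_sub_distrib, ← sum_const_rounds, Finset.mul_sum,
    ← Finset.sum_add_distrib, ← Finset.sum_add_distrib]
  refine Finset.sum_le_sum fun t ht => ?_
  rw [← Finset.sum_sub_distrib]
  have hd := hdata t (Finset.mem_range.1 ht)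
  have h1 := mul_le_mul_of_nonneg_left (sum_norm_sub_le_dispersion (X t) i) hL0
  rw [Finset.mul_sum] at h1
  calc _ ≤ ∑ j, (L * ‖X t i - X t j‖
        + inner ℝ (lossGrad (h t j) (z t j) (X t j)) (X t j - y) + L * ‖y - ystar‖) := by
        refine Finset.sum_le_sum fun j _ => ?_
        have a1 := loss_sub_le_norm (hd j).1 (hd j).2 (y := X t j) (hXR t i)
        have a2 := loss_sub_le_inner (h t j) (z t j) (X t j) y
        have a3 := loss_sub_le_norm (hd j).1 (hd j).2 (y := ystar) hy
        rw [← hL] at a1 a3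
        linarith
    _ ≤ _ := by
        rw [Finset.sum_add_distrib, Finset.sum_add_distrib]
        linarith

/-- Linearized regret may be negative of order `T`; this is what limits the rate for the violations.
-/
lemma neg_le_sum_inner_lossGrad (hL : L = α_h * R + Real.sqrt α_h * α_z)
    (hdata : ∀ t < T, ∀ j, ‖h t j‖ ^ 2 ≤ α_h ∧ |z t j| ≤ α_z) (hXR : ∀ t i, ‖X t i‖ ≤ R)
    (hy : ‖y‖ ≤ R) (hL0 : 0 ≤ L) :
    -(n * T * (2 * L * R)) ≤
      ∑ t ∈ Finset.range T, ∑ j, inner ℝ (lossGrad (h t j) (z t j) (X t j)) (X t j - y) := by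
  rw [← mul_neg, ← sum_const_rounds]
  refine Finset.sum_le_sum fun t ht => Finset.sum_le_sum fun j _ => ?_
  have hd := hdata t (Finset.mem_range.1 ht) j
  have a1 := norm_lossGrad_le hd.1 hd.2 (hXR t j)
  rw [← hL] at a1
  have a2 := (abs_le.1 (abs_real_inner_le_norm (lossGrad (h t j) (z t j) (X t j)) (X t j - y))).1
  have a3 : ‖X t j - y‖ ≤ 2 * R := by
    have := norm_sub_le (X t j) y
    linarith [hXR t j]
  have := mul_le_mul a1 a3 (norm_nonneg _) hL0
  linarith

variable {b : ℝ}

lemma IsTrajectory.sum_inner_add_violSq_le (hW : IsNetwork G W)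
    (hX : IsTrajectory W k η τ r X g) (hk : ∀ q, ‖k q‖ ≤ K) (hc : 1 < c) (hs : 1 ≤ s)
    (hδ : 0 < δ) (hK : δ ≤ K) (hη : 0 < η) (hτ : 0 < τ)
    (hητ : η * τ * (s * K ^ 2) * c = 1) (hQ : 0 ≤ Q) (hQτ : Q * τ = T)
    (hr : 0 ≤ r) (hrR : r ≤ R) (hXR : ∀ t i, ‖X t i‖ ≤ R)
    (hg : ∀ t < T, ∀ j, ‖g t j‖ ≤ b) (hy : ‖y‖ ≤ r) (hky : ∀ q, inner ℝ (k q) y ≤ 0) :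
    η * T ≤ Q / δ ^ 2 ∧
    ∑ t ∈ Finset.range T, ∑ j, inner ℝ (g t j) (X t j - y)
      + τ / 2 * ∑ t ∈ Finset.range T, ∑ j, violSq k (X t j) ≤
    2 * c * s * n * K ^ 2 * R ^ 2 * τ + c / (c - 1) * (n * b ^ 2 * (Q / δ ^ 2)) := by
  have hK0 : 0 < K := hδ.trans_le hK
  have hc1 : 0 < c - 1 := sub_pos.2 hc
  have hs' : (1 : ℝ) ≤ s := by exact_mod_cast hs
  have h1 := hX.sum_inner_le hW hk hc hη.le hτ.le hητ hr hy hky T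
  have h2 : ∑ t ∈ Finset.range T, ∑ j, ‖g t j‖ ^ 2 ≤ n * T * b ^ 2 := by
    rw [← sum_const_rounds]
    exact Finset.sum_le_sum fun t ht => Finset.sum_le_sum fun j _ =>
      pow_le_pow_left₀ (norm_nonneg _) (hg t (Finset.mem_range.1 ht) j) 2
  have h3 : ∑ j, ‖X 0 j - y‖ ^ 2 ≤ n * (2 * R) ^ 2 := by
    calc _ ≤ ∑ _j : Fin n, (2 * R) ^ 2 := by
          refine Finset.sum_le_sum fun j _ => pow_le_pow_left₀ (norm_nonneg _) ?_ 2
          have := norm_sub_le (X 0 j) y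
          linarith [hXR 0 j]
      _ = _ := by simp
  have h4 : 0 ≤ ∑ j, ‖X T j - y‖ ^ 2 := Finset.sum_nonneg fun _ _ => sq_nonneg _
  have h5 : η * T ≤ Q / δ ^ 2 := by
    rw [← hQτ, le_div_iff₀ (by positivity)]
    have : η * τ * δ ^ 2 ≤ 1 := by
      rw [← hητ]
      calc η * τ * δ ^ 2 = η * τ * (1 * δ ^ 2) * 1 := by ring
        _ ≤ η * τ * (s * K ^ 2) * c := by gcongr
    calc η * (Q * τ) * δ ^ 2 = Q * (η * τ * δ ^ 2) := by ring
      _ ≤ Q * 1 := by gcongr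
      _ = Q := mul_one Q
  refine ⟨h5, ?_⟩
  set N := ∑ t ∈ Finset.range T, ∑ j, inner ℝ (g t j) (X t j - y)
  set V := ∑ t ∈ Finset.range T, ∑ j, violSq k (X t j)
  have h6 : 2 * η * N + η * τ * V ≤ n * (2 * R) ^ 2 + c / (c - 1) * η ^ 2 * (n * T * b ^ 2) := by
    have : c / (c - 1) * η ^ 2 * ∑ t ∈ Finset.range T, ∑ j, ‖g t j‖ ^ 2 ≤
        c / (c - 1) * η ^ 2 * (n * T * b ^ 2) := by gcongr
    linarith
  -- The multiplier equals `1 / (2 * η)`, by the step-size identity.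
  have h7 := mul_le_mul_of_nonneg_left h6
    (show 0 ≤ τ * (s * K ^ 2) * c / 2 by positivity)
  have e1 : τ * (s * K ^ 2) * c / 2 * (2 * η * N + η * τ * V) = N + τ / 2 * V := by
    linear_combination (N + τ / 2 * V) * hητ
  have e2 : τ * (s * K ^ 2) * c / 2 *
      (n * (2 * R) ^ 2 + c / (c - 1) * η ^ 2 * (n * T * b ^ 2)) =
      2 * c * s * n * K ^ 2 * R ^ 2 * τ + 1 / 2 * (c / (c - 1) * (n * b ^ 2 * (η * T))) := by
    linear_combination (1 / 2 * (c / (c - 1) * (n * b ^ 2 * (η * T)))) * hητ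
  have h8 : c / (c - 1) * (n * b ^ 2 * (η * T)) ≤ c / (c - 1) * (n * b ^ 2 * (Q / δ ^ 2)) := by
    gcongr
  have h9 : 0 ≤ c / (c - 1) * (n * b ^ 2 * (Q / δ ^ 2)) := by positivity
  rw [e1, e2] at h7
  linarith

/-- Pathwise regret bound. -/
lemma IsTrajectory.regret_add_noise_le {P : ℝ} {ystar : Vec m} (hn : 1 ≤ n) (hm : 1 ≤ m)
    (hW : IsNetwork G W) (hσ : sigma2 W < 1)
    (hX : IsTrajectory W k η τ r X g) (hk : ∀ q, ‖k q‖ ≤ K) (hc : 1 < c) (hs : 1 ≤ s)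
    (hδ : 0 < δ) (hK : δ ≤ K) (hη : 0 < η) (hτ : 0 < τ)
    (hητ : η * τ * (s * K ^ 2) * c = 1) (hQ : 1 ≤ Q) (hQτ : Q * τ = T)
    (hQP : Q ≤ P) (hτP : τ ≤ P)
    (hr : 0 ≤ r) (hrR : r ≤ R) (hrτ : (R - r) * τ ≤ 1) (hXR : ∀ t i, ‖X t i‖ ≤ R)
    (hL : L = α_h * R + Real.sqrt α_h * α_z) (hLδ : δ ≤ L) (hRδ : δ ≤ R)
    (hdata : ∀ t < T, ∀ j, ‖h t j‖ ^ 2 ≤ α_h ∧ |z t j| ≤ α_z)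
    (hg : ∀ t < T, ∀ j, ‖g t j‖ ≤ m * L) (hy : ‖y‖ ≤ r) (hky : ∀ q, inner ℝ (k q) y ≤ 0)
    (hyy : ‖y - ystar‖ ≤ R - r) (i : Fin n) :
    totalLoss T h z (fun t => X t i) - totalLoss T h z (fun _ => ystar) + noise T h z X g y ≤
      regretConst s c δ * (1 / (1 - sigma2 W) ^ 2 *
        ((m : ℝ) ^ 2 * (n : ℝ) ^ (5 / 2 : ℝ) * L ^ 2 + (n : ℝ) ^ (5 / 2 : ℝ) * L * R
          + (n : ℝ) ^ 4 * L ^ 2) + n * K ^ 2 * R ^ 2) * P := by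
  have hK0 : 0 < K := hδ.trans_le hK
  have hL0 : 0 < L := hδ.trans_le hLδ
  have hn1 : (1 : ℝ) ≤ n := by exact_mod_cast hn
  have hm1 : (1 : ℝ) ≤ m := by exact_mod_cast hm
  have h1 := totalLoss_sub_le (ystar := ystar) hL hdata hXR (hy.trans hrR) hL0.le i
  obtain ⟨h2, h3⟩ := hX.sum_inner_add_violSq_le hW hk hc hs hδ hK hη hτ hητ
    (zero_le_one.trans hQ) hQτ hr hrR hXR hg hy hky
  have h4 := hX.sum_dispersion_le hn hW hσ hk hc hs hK0 hη.le hτ.le hητ hr hrR hXR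
    (by positivity) hg
  have h5 := noise_eq T h z X g y
  have h6 : T * (R - r) ≤ Q := by
    rw [← hQτ]
    nlinarith
  have h7 : (n : ℝ) * T * (L * ‖y - ystar‖) ≤ n * L * Q := by
    calc (n : ℝ) * T * (L * ‖y - ystar‖) ≤ n * T * (L * (R - r)) := by gcongr
      _ = n * L * (T * (R - r)) := by ring
      _ ≤ _ := by gcongr
  set D := ∑ t ∈ Finset.range T, dispersion (X t)
  set V := ∑ t ∈ Finset.range T, ∑ j, violSq k (X t j) with hV
  set U := ∑ t ∈ Finset.range T, Real.sqrt (∑ j, violSq k (X t j)) with hU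
  set σ := sigma2 W
  have hσ1 : 0 < 1 - σ := sub_pos.2 hσ
  set w := 1 / (1 - σ) with hw
  have hw1 : 1 ≤ w := by
    rw [hw, le_div_iff₀ hσ1]
    linarith [sigma2_nonneg W]
  have hD : D ≤ w * (Real.sqrt n * R + Real.sqrt n * (T * (η * (m * L))) + U / K
      + Real.sqrt n * (T * (R - r))) := by
    rw [hw, one_div, ← div_eq_inv_mul, le_div_iff₀ hσ1]
    linarith
  set A := L * (2 * n) * w / K with hA
  have hA0 : 0 ≤ A := by positivity
  -- Young's inequality in each round: the term in `V` is cancelled by the penalty gain in `h3`, and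
  -- the remainder adds up to `A ^ 2 * Q / 2` because `T / τ = Q`.
  have hAU : A * U ≤ τ / 2 * V + A ^ 2 * Q / 2 := by
    have : ∀ t ∈ Finset.range T, A * Real.sqrt (∑ j, violSq k (X t j)) ≤
        τ / 2 * (∑ j, violSq k (X t j)) + A ^ 2 / (2 * τ) := by
      intro t _
      have h0 : 0 ≤ ∑ j, violSq k (X t j) := Finset.sum_nonneg fun _ _ => violSq_nonneg _ _
      have e := Real.sq_sqrt h0
      set v := Real.sqrt (∑ j, violSq k (X t j))
      rw [← e]
      have : τ / 2 * v ^ 2 + A ^ 2 / (2 * τ) - A * v = (τ * v - A) ^ 2 / (2 * τ) := by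
        field_simp
        ring
      have h9 : 0 ≤ (τ * v - A) ^ 2 / (2 * τ) := by positivity
      linarith
    have := Finset.sum_le_sum this
    rw [← Finset.mul_sum, Finset.sum_add_distrib, ← Finset.mul_sum, Finset.sum_const,
      Finset.card_range, nsmul_eq_mul, ← hQτ, ← hV, ← hU] at this
    refine this.trans_eq ?_
    field_simp
  have hA2 : A ^ 2 * Q / 2 ≤ 2 * n ^ 2 * L ^ 2 * w ^ 2 / δ ^ 2 * Q := by
    have e : A ^ 2 * Q / 2 = 2 * n ^ 2 * L ^ 2 * w ^ 2 / K ^ 2 * Q := by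
      rw [hA]; field_simp
    rw [e]
    gcongr
  have hLD : L * (2 * n) * D ≤ 2 * (n * Real.sqrt n) * w * L * R * Q
      + 2 * (n * Real.sqrt n) * w * L * (Q / δ ^ 2 * (m * L))
      + 2 * (n * Real.sqrt n) * w * L * Q + A * U := by
    have hR0 : 0 < R := hδ.trans_le hRδ
    calc L * (2 * n) * D ≤ L * (2 * n) * (w * (Real.sqrt n * R
          + Real.sqrt n * (T * (η * (m * L))) + U / K + Real.sqrt n * (T * (R - r)))) := by gcongr
      _ = 2 * (n * Real.sqrt n) * w * L * R * 1
          + 2 * (n * Real.sqrt n) * w * L * (η * T * (m * L))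
          + 2 * (n * Real.sqrt n) * w * L * (T * (R - r)) + A * U := by rw [hA]; ring
      _ ≤ _ := by gcongr
  have hsq : (n : ℝ) * Real.sqrt n ≤ (n : ℝ) ^ (5 / 2 : ℝ) := by
    rw [Real.sqrt_eq_rpow]
    nth_rewrite 1 [← Real.rpow_one (n : ℝ)]
    rw [← Real.rpow_add (by positivity)]
    exact Real.rpow_le_rpow_of_exponent_le hn1 (by norm_num)
  have hnp : (n : ℝ) ≤ (n : ℝ) ^ (5 / 2 : ℝ) := by
    nth_rewrite 1 [← Real.rpow_one (n : ℝ)]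
    exact Real.rpow_le_rpow_of_exponent_le hn1 (by norm_num)
  have key := regret_arith (s := s) (K := K) hc hδ hn1 hm1 hLδ hRδ hw1 hQ hQP hτ hτP
    (by positivity) hsq hnp
  have ew : 1 / (1 - σ) ^ 2 = w ^ 2 := by rw [hw, div_pow, one_pow]
  rw [ew]
  linarith

/-- Pathwise bound on the constraint violations. -/
lemma IsTrajectory.sum_viol_add_noise_le {ρ : ℝ} (hn : 1 ≤ n) (hm : 1 ≤ m)
    (hW : IsNetwork G W)
    (hX : IsTrajectory W k η τ r X g) (hk : ∀ q, ‖k q‖ ≤ K) (hc : 1 < c) (hs : 1 ≤ s)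
    (hδ : 0 < δ) (hK : δ ≤ K) (hη : 0 < η) (hτ : 1 ≤ τ)
    (hητ : η * τ * (s * K ^ 2) * c = 1) (hQ : 1 ≤ Q) (hQτ : Q * τ = T)
    (hρ : 0 < ρ) (hρτ : ρ ^ 2 = τ)
    (hr : 0 ≤ r) (hrR : r ≤ R) (hXR : ∀ t i, ‖X t i‖ ≤ R)
    (hL : L = α_h * R + Real.sqrt α_h * α_z) (hLδ : δ ≤ L) (hRδ : δ ≤ R)
    (hdata : ∀ t < T, ∀ j, ‖h t j‖ ^ 2 ≤ α_h ∧ |z t j| ≤ α_z)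
    (hg : ∀ t < T, ∀ j, ‖g t j‖ ≤ m * L) (hy : ‖y‖ ≤ r) (hky : ∀ q, inner ℝ (k q) y ≤ 0) :
    ∑ t ∈ Finset.range T, ∑ i, ∑ q, viol (k q) (X t i)
        + (m * L * K * R * ρ)⁻¹ * noise T h z X g y ≤
      violConst s c δ * (m * n * L * K * R) * (T / ρ) := by
  have hK0 : 0 < K := hδ.trans_le hK
  have hL0 : 0 < L := hδ.trans_le hLδ
  have hR0 : 0 < R := hδ.trans_le hRδ
  have hn1 : (1 : ℝ) ≤ n := by exact_mod_cast hn
  have hm1 : (1 : ℝ) ≤ m := by exact_mod_cast hm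
  have hc1 : 0 < c - 1 := sub_pos.2 hc
  obtain ⟨-, h3⟩ := hX.sum_inner_add_violSq_le hW hk hc hs hδ hK hη (one_pos.trans_le hτ) hητ
    (zero_le_one.trans hQ) hQτ hr hrR hXR hg hy hky
  have h4 := neg_le_sum_inner_lossGrad hL hdata hXR (hy.trans hrR) hL0.le
  have h5 := noise_eq T h z X g y
  set M := noise T h z X g y
  set V := ∑ t ∈ Finset.range T, ∑ j, violSq k (X t j) with hV
  set Z := m * L * K * R with hZ
  have hZ0 : 0 < Z := by positivity
  have hτT : τ ≤ T := by rw [← hQτ]; nlinarith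
  have hQT : Q ≤ T := by rw [← hQτ]; nlinarith
  have h6 : τ / 2 * V + M ≤ n * T * (2 * L * R + 2 * c * s * K ^ 2 * R ^ 2
      + c / (c - 1) * ((m * L) ^ 2 / δ ^ 2)) := by
    have a1 : 2 * c * s * n * K ^ 2 * R ^ 2 * τ ≤ 2 * c * s * n * K ^ 2 * R ^ 2 * T := by gcongr
    have a2 : c / (c - 1) * (n * (m * L) ^ 2 * (Q / δ ^ 2)) ≤
      c / (c - 1) * (n * (m * L) ^ 2 * (T / δ ^ 2)) := by gcongr
    have e : n * T * (2 * L * R + 2 * c * s * K ^ 2 * R ^ 2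
      + c / (c - 1) * ((m * L) ^ 2 / δ ^ 2)) = n * T * (2 * L * R)
        + 2 * c * s * n * K ^ 2 * R ^ 2 * T
        + c / (c - 1) * (n * (m * L) ^ 2 * (T / δ ^ 2)) := by ring
    rw [e]
    linarith
  -- Young's inequality with weight `Z / ρ`, where `ρ` is the square root of `τ`: both terms become
  -- of order `T / ρ`.
  have h7 : ∑ t ∈ Finset.range T, ∑ i, ∑ q, viol (k q) (X t i) ≤
      (Z * ρ)⁻¹ * (τ / 2 * V) + n * T * (s * Z / (2 * ρ)) := by
    rw [← sum_const_rounds, hV, Finset.mul_sum, Finset.mul_sum, ← Finset.sum_add_distrib]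
    refine Finset.sum_le_sum fun t _ => ?_
    rw [Finset.mul_sum, Finset.mul_sum, ← Finset.sum_add_distrib]
    refine Finset.sum_le_sum fun j _ => ?_
    have e : (s : ℝ) * Z / (2 * ρ) = ∑ _q : Fin s, Z / (2 * ρ) := by simp; ring
    rw [violSq, e, Finset.mul_sum, Finset.mul_sum, ← Finset.sum_add_distrib]
    refine Finset.sum_le_sum fun q _ => ?_
    set v := viol (k q) (X t j)
    have e2 : (Z * ρ)⁻¹ * (τ / 2 * v ^ 2) + Z / (2 * ρ) - v = (ρ * v - Z) ^ 2 / (2 * (Z * ρ)) := by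
      rw [← hρτ]
      field_simp
      ring
    have h9 : 0 ≤ (ρ * v - Z) ^ 2 / (2 * (Z * ρ)) := by positivity
    linarith
  have h8 := mul_le_mul_of_nonneg_left h6 (show 0 ≤ (Z * ρ)⁻¹ by positivity)
  have key := viol_arith (s := s) hc hδ hm1 hLδ hRδ hK
  rw [← hZ] at key
  have h9 := mul_le_mul_of_nonneg_left key (show 0 ≤ (n : ℝ) * (T / ρ) by positivity)
  set B := 2 * L * R + 2 * c * s * K ^ 2 * R ^ 2 + c / (c - 1) * ((m * L) ^ 2 / δ ^ 2)
  have e1 : (n : ℝ) * (T / ρ) * (B / Z + s * Z / 2)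
      = (Z * ρ)⁻¹ * (n * T * B) + n * T * (s * Z / (2 * ρ)) := by
    field_simp
  have e2 : (n : ℝ) * (T / ρ) * (violConst s c δ * Z)
      = violConst s c δ * (m * n * L * K * R) * (T / ρ) := by
    rw [hZ]; ring
  rw [e1, e2] at h9
  linarith

end Bounds

/-! ### The algorithm as a penalized trajectory. -/

section Run

variable {n m s : ℕ} {W : Matrix (Fin n) (Fin n) ℝ} {k : Fin s → Vec m} {R η reg ε ξ : ℝ}
  {h : ℕ → Fin n → Vec m} {z : ℕ → Fin n → ℝ} {x₁ : Fin n → Vec m}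

lemma viol_eq_zero_of_mem_decisionSet {x : Vec m} (hx : x ∈ decisionSet k R) (q : Fin s) :
    viol (k q) x = 0 :=
  max_eq_left (hx.1 q)

/-- After the first update this is the algorithm's rule; initially both sides vanish because `x₁` is
feasible. -/
lemma run_mu (hx₁ : ∀ j, x₁ j ∈ decisionSet k R) (u : ℕ → Fin n → Vec m) (t : ℕ) (i : Fin n)
    (q : Fin s) : (run W k R η reg ε ξ h z x₁ u t).mu i q =
      viol (k q) ((run W k R η reg ε ξ h z x₁ u t).x i) / reg := by
  cases t with
  | zero => simp [run, viol_eq_zero_of_mem_decisionSet (hx₁ i)]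
  | succ t => rfl

lemma isTrajectory_run (hR : 0 ≤ R) (hx₁ : ∀ j, x₁ j ∈ decisionSet k R)
    (u : ℕ → Fin n → Vec m) :
    IsTrajectory W k η reg⁻¹ (|1 - ξ| * R) (fun t => (run W k R η reg ε ξ h z x₁ u t).x)
      (fun t j => gradEst ε (loss (h t j) (z t j)) (u t j)
        ((run W k R η reg ε ξ h z x₁ u t).x j)) := by
  intro t i
  have e : (run W k R η reg ε ξ h z x₁ u (t + 1)).x i = newEstimate W k R η ε ξ (h t) (z t) (u t)
    (run W k R η reg ε ξ h z x₁ u t) i := rfl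
  simp only [e, newEstimate, shrunkBall_eq _ hR, localStep, run_mu hx₁, sum_smul_violGrad]

lemma norm_run_le (hR : 0 ≤ R) (hx₁ : ∀ j, x₁ j ∈ decisionSet k R) {ρ : ℝ} (hRρ : R ≤ ρ)
    (hξ : |1 - ξ| * R ≤ ρ) (u : ℕ → Fin n → Vec m) (t : ℕ) (i : Fin n) :
    ‖(run W k R η reg ε ξ h z x₁ u t).x i‖ ≤ ρ := by
  cases t with
  | zero => exact (hx₁ i).2.trans hRρ
  | succ t =>
    refine le_trans ?_ hξ
    have e : (run W k R η reg ε ξ h z x₁ u (t + 1)).x i = _ := isTrajectory_run hR hx₁ u t i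
    rw [e, ← mem_closedBall_zero_iff]
    exact (proj_spec (Metric.nonempty_closedBall.2 (by positivity)) Metric.isClosed_closedBall
      (convex_closedBall _ _) _).1

/-- Only directions of earlier rounds matter, whence the independence from the current ones. -/
lemma run_congr {u u' : ℕ → Fin n → Vec m} {t : ℕ} (huu : ∀ r < t, u r = u' r) :
    run W k R η reg ε ξ h z x₁ u t = run W k R η reg ε ξ h z x₁ u' t := by
  induction t with
  | zero => rfl
  | succ t ih =>
    rw [run, run, ih fun r hr => huu r (by omega), huu t (by omega)]

lemma continuous_penalty (k : Fin s → Vec m) : Continuous (penalty k) := by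
  unfold penalty viol
  fun_prop

lemma continuous_loss (h : Vec m) (z : ℝ) : Continuous (loss h z) := by
  unfold loss
  fun_prop

lemma continuous_viol (k : Vec m) : Continuous (viol k) := by
  unfold viol
  fun_prop

lemma measurable_run (hR : 0 ≤ R) (hx₁ : ∀ j, x₁ j ∈ decisionSet k R) (t : ℕ) (i : Fin n) :
    Measurable fun u : ℕ → Fin n → Vec m => (run W k R η reg ε ξ h z x₁ u t).x i := by
  induction t generalizing i with
  | zero => exact measurable_const
  | succ t ih =>
    have e : (fun u : ℕ → Fin n → Vec m => (run W k R η reg ε ξ h z x₁ u (t + 1)).x i) = _ :=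
      funext fun u => isTrajectory_run hR hx₁ u t i
    rw [e]
    refine (continuous_proj (Metric.nonempty_closedBall.2 (by positivity))
      Metric.isClosed_closedBall (convex_closedBall _ _)).measurable.comp ?_
    refine Finset.measurable_sum _ fun j _ => ?_
    have h1 := ih j
    have h2 : Measurable fun u : ℕ → Fin n → Vec m => u t j := by fun_prop
    have h3 := (continuous_penalty k).measurable.comp h1
    have h4 := (continuous_loss (h t j) (z t j)).measurable
    unfold gradEst
    fun_prop

end Run

/-! ### Independence and zero mean of the gradient errors. -/

section Noise

variable {Ω : Type*} [MeasurableSpace Ω] {P : Measure Ω} {m : ℕ}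

/-- The two-point estimate along a uniform direction is unbiased. -/
lemma integral_gradient_error [IsProbabilityMeasure P] (hm : 1 ≤ m) (h : Vec m)
    {U Y : Ω → Vec m} (hU : Measurable U)
    (hlaw : P.map U = uniformSphere m) (hY : Measurable Y) {B : ℝ} (hB : ∀ ω, ‖Y ω‖ ≤ B)
    (hind : IndepFun Y U P) :
    Integrable (fun ω => m * inner ℝ h (U ω) * inner ℝ (U ω) (Y ω) - inner ℝ h (Y ω)) P ∧
    ∫ ω, (m * inner ℝ h (U ω) * inner ℝ (U ω) (Y ω) - inner ℝ h (Y ω)) ∂P = 0 := by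
  have hm0 : (m : ℝ) ≠ 0 := by positivity
  have hsphere := isProbabilityMeasure_uniformSphere hm
  -- The entries of `m v vᵀ - I`, which have mean zero under the uniform distribution.
  let f : Fin m → Fin m → Vec m → ℝ := fun p q v => m * (v p * v q) - if p = q then 1 else 0
  have hf : ∀ p q, Measurable (f p q) := fun p q => by fun_prop
  have hfi : ∀ p q, Integrable (f p q) (uniformSphere m) := fun p q =>
    ((integrable_coord_mul_coord hm p q).const_mul _).sub (integrable_const _)
  have hf0 : ∀ p q, ∫ v, f p q v ∂(uniformSphere m) = 0 := by
    intro p q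
    rw [integral_sub ((integrable_coord_mul_coord hm p q).const_mul _) (integrable_const _),
      integral_const_mul, integral_coord_mul_coord hm]
    by_cases hpq : p = q <;> simp [hpq, hm0]
  have hind' : ∀ p q, IndepFun (fun ω => Y ω q) (fun ω => f p q (U ω)) P := fun p q =>
    hind.comp (φ := fun y : Vec m => y q) (by fun_prop) (hf p q)
  have hYi : ∀ q, Integrable (fun ω => Y ω q) P := fun q =>
    Integrable.of_bound (C := B) (by fun_prop)
      (Filter.Eventually.of_forall fun ω => (PiLp.norm_apply_le (Y ω) q).trans (hB ω))
  have hfU : ∀ p q, Integrable (fun ω => f p q (U ω)) P := by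
    intro p q
    have := hfi p q
    rw [← hlaw] at this
    exact this.comp_measurable hU
  have hterm : ∀ p q, Integrable (fun ω => h p * (Y ω q * f p q (U ω))) P := fun p q =>
    ((hind' p q).integrable_mul (hYi q) (hfU p q)).const_mul _
  have hterm0 : ∀ p q, ∫ ω, h p * (Y ω q * f p q (U ω)) ∂P = 0 := by
    intro p q
    rw [integral_const_mul, (hind' p q).integral_fun_mul_eq_mul_integral
      (hYi q).aestronglyMeasurable (hfU p q).aestronglyMeasurable,
      ← integral_map (f := f p q) hU.aemeasurable (hf p q).aestronglyMeasurable, hlaw, hf0]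
    simp
  have e : ∀ ω, m * inner ℝ h (U ω) * inner ℝ (U ω) (Y ω) - inner ℝ h (Y ω)
      = ∑ p, ∑ q, h p * (Y ω q * f p q (U ω)) := by
    intro ω
    have e1 : ∀ p q, h p * (Y ω q * f p q (U ω))
        = m * ((h p * U ω p) * (U ω q * Y ω q)) - if p = q then h p * Y ω q else 0 := by
      intro p q
      by_cases hpq : p = q
      · simp only [f, hpq, if_true]; ring
      · simp only [f, hpq, if_false]; ring
    simp only [e1, Finset.sum_sub_distrib, Finset.sum_ite_eq, Finset.mem_univ, if_true,
      ← Finset.mul_sum, ← Finset.sum_mul]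
    simp only [PiLp.inner_apply, RCLike.inner_apply, conj_trivial]
    rw [mul_assoc]
    simp only [mul_comm]
  simp only [e]
  refine ⟨integrable_finsetSum _ fun p _ => integrable_finsetSum _ fun q _ => hterm p q, ?_⟩
  rw [integral_finsetSum _ fun p _ => integrable_finsetSum _ fun q _ => hterm p q]
  refine Finset.sum_eq_zero fun p _ => ?_
  rw [integral_finsetSum _ fun q _ => hterm p q]
  exact Finset.sum_eq_zero fun q _ => hterm0 p q

lemma integrable_continuous_comp [IsFiniteMeasure P] {X : Ω → Vec m} (hX : Measurable X) {ρ : ℝ}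
    (hρ : ∀ ω, ‖X ω‖ ≤ ρ) {f : Vec m → ℝ} (hf : Continuous f) :
    Integrable (fun ω => f (X ω)) P := by
  obtain ⟨C, hC⟩ := (isCompact_closedBall (0 : Vec m) ρ).exists_bound_of_continuousOn
    hf.continuousOn
  exact Integrable.of_bound (C := C) (hf.measurable.comp hX).aestronglyMeasurable
    (Filter.Eventually.of_forall fun ω => hC _ (by simpa using hρ ω))

variable {n s : ℕ} {W : Matrix (Fin n) (Fin n) ℝ} {k : Fin s → Vec m} {R η reg ε ξ : ℝ}
  {h : ℕ → Fin n → Vec m} {z : ℕ → Fin n → ℝ} {x₁ : Fin n → Vec m} {T : ℕ}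
  {u : ℕ → Fin n → Ω → Vec m}

/-- The estimates of round `t` are measurable and independent of the directions of round `t`. -/
lemma measurable_indepFun_run (hR : 0 ≤ R) (hx₁ : ∀ j, x₁ j ∈ decisionSet k R)
    (hu : ∀ t < T, ∀ j, Measurable (u t j))
    (hind : iIndepFun (fun (p : Fin T × Fin n) => u p.1 p.2) P) {t : ℕ} (ht : t < T)
    (i : Fin n) :
    Measurable (fun ω => (run W k R η reg ε ξ h z x₁ (fun t j => u t j ω) t).x i) ∧
    ∀ j, IndepFun (fun ω => (run W k R η reg ε ξ h z x₁ (fun t j => u t j ω) t).x i)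
      (u t j) P := by
  classical
  let A : Finset (Fin T × Fin n) := Finset.univ.filter fun p => p.1.1 < t
  -- Padding the earlier directions by zero exhibits the estimate as a measurable function of the
  -- directions indexed by `A`.
  let ext : (A → Vec m) → ℕ → Fin n → Vec m := fun v r l =>
    if hr : r < t then v ⟨(⟨r, hr.trans ht⟩, l), by simp [A, hr]⟩ else 0
  have hext : Measurable ext := by
    refine measurable_pi_iff.2 fun r => measurable_pi_iff.2 fun l => ?_
    by_cases hr : r < t
    · simp only [ext, hr, dite_true]
      fun_prop
    · simp only [ext, hr, dite_false]
      exact measurable_const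
  let φ : (A → Vec m) → Vec m := fun v => (run W k R η reg ε ξ h z x₁ (ext v) t).x i
  have hφ : Measurable φ := (measurable_run hR hx₁ t i).comp hext
  have hrestr : Measurable fun ω => (fun p : A => u p.1.1 p.1.2 ω) :=
    measurable_pi_iff.2 fun p => hu _ p.1.1.2 _
  have e : (fun ω => (run W k R η reg ε ξ h z x₁ (fun t j => u t j ω) t).x i)
      = φ ∘ fun ω => (fun p : A => u p.1.1 p.1.2 ω) := by
    funext ω
    simp only [φ, Function.comp]
    rw [run_congr (u' := ext fun p : A => u p.1.1 p.1.2 ω)]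
    intro r hr
    funext l
    simp only [ext, hr, dite_true]
  rw [e]
  refine ⟨hφ.comp hrestr, fun j => ?_⟩
  let B : Finset (Fin T × Fin n) := {(⟨t, ht⟩, j)}
  have hAB : Disjoint A B := by
    rw [Finset.disjoint_singleton_right]
    simp [A]
  have h1 := hind.indepFun_finset A B hAB fun p => hu _ p.1.2 _
  exact h1.comp (φ := φ) (ψ := fun v : B → Vec m => v ⟨(⟨t, ht⟩, j), by simp [B]⟩) hφ
    (by fun_prop)

lemma integral_noise [IsProbabilityMeasure P] (hm : 1 ≤ m) (hε : ε ≠ 0) (hR : 0 ≤ R)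
    (hx₁ : ∀ j, x₁ j ∈ decisionSet k R)
    (hu : ∀ t < T, ∀ j, Measurable (u t j) ∧ P.map (u t j) = uniformSphere m)
    (hind : iIndepFun (fun (p : Fin T × Fin n) => u p.1 p.2) P) (y : Vec m) :
    let X := fun ω t => (run W k R η reg ε ξ h z x₁ (fun t j => u t j ω) t).x
    let N := fun ω => noise T h z (X ω)
      (fun t j => gradEst ε (loss (h t j) (z t j)) (u t j ω) (X ω t j)) y
    Integrable N P ∧ ∫ ω, N ω ∂P = 0 := by
  intro X N
  have key : ∀ t < T, ∀ j,
      Integrable (fun ω => inner ℝ (gradEst ε (loss (h t j) (z t j)) (u t j ω) (X ω t j)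
        - lossGrad (h t j) (z t j) (X ω t j)) (X ω t j - y)) P ∧
      ∫ ω, inner ℝ (gradEst ε (loss (h t j) (z t j)) (u t j ω) (X ω t j)
        - lossGrad (h t j) (z t j) (X ω t j)) (X ω t j - y) ∂P = 0 := by
    intro t ht j
    obtain ⟨hX1, hX2⟩ := measurable_indepFun_run (W := W) (η := η) (reg := reg) (ε := ε)
      (ξ := ξ) (h := h) (z := z) hR hx₁ (fun t ht j => (hu t ht j).1) hind ht j
    -- Moving the scalar residual onto `x - y` leaves an error linear in `ψ`, of the form treated by
    -- `integral_gradient_error`.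
    let ψ : Vec m → Vec m := fun x => (inner ℝ (h t j) x - z t j) • (x - y)
    have hψ : Continuous ψ := by fun_prop
    set ρ := max R (|1 - ξ| * R)
    obtain ⟨B, hB⟩ := (isCompact_closedBall (0 : Vec m) ρ).exists_bound_of_continuousOn
      hψ.continuousOn
    have hXρ : ∀ ω, ‖X ω t j‖ ≤ ρ := fun ω =>
      norm_run_le hR hx₁ (le_max_left _ _) (le_max_right _ _) _ t j
    have := integral_gradient_error hm (h t j) (hu t ht j).1 (hu t ht j).2
      (Y := fun ω => ψ (X ω t j)) (hψ.measurable.comp hX1) (B := B)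
      (fun ω => hB _ (by simpa using hXρ ω))
      ((hX2 j).comp hψ.measurable measurable_id)
    convert this using 4 with ω ω
    all_goals
      simp only [gradEst_loss hε, lossGrad, ψ, inner_sub_left (_ • _), real_inner_smul_left,
        real_inner_smul_right]
      ring
  have hint : ∀ t ∈ Finset.range T, Integrable (fun ω => ∑ j,
      inner ℝ (gradEst ε (loss (h t j) (z t j)) (u t j ω) (X ω t j)
        - lossGrad (h t j) (z t j) (X ω t j)) (X ω t j - y)) P := fun t ht =>
    integrable_finsetSum _ fun j _ => (key t (Finset.mem_range.1 ht) j).1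
  refine ⟨integrable_finsetSum _ hint, ?_⟩
  simp only [N, noise]
  rw [integral_finsetSum _ hint]
  refine Finset.sum_eq_zero fun t ht => ?_
  rw [integral_finsetSum _ fun j _ => (key t (Finset.mem_range.1 ht) j).1]
  exact Finset.sum_eq_zero fun j _ => (key t (Finset.mem_range.1 ht) j).2

lemma integrable_regret [IsProbabilityMeasure P] (hR : 0 ≤ R) (hx₁ : ∀ j, x₁ j ∈ decisionSet k R)
    (hu : ∀ t < T, ∀ j, Measurable (u t j))
    (hind : iIndepFun (fun (p : Fin T × Fin n) => u p.1 p.2) P) (ystar : Vec m) (i : Fin n) :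
    Integrable (fun ω => regret T h z ystar
      (run W k R η reg ε ξ h z x₁ (fun t j => u t j ω)) i) P := by
  refine Integrable.sub ?_ (integrable_const _)
  refine integrable_finsetSum _ fun t ht => integrable_finsetSum _ fun j _ => ?_
  exact integrable_continuous_comp
    (measurable_indepFun_run hR hx₁ hu hind (Finset.mem_range.1 ht) i).1
    (fun ω => norm_run_le hR hx₁ (le_max_left R (|1 - ξ| * R)) (le_max_right _ _) _ t i)
    (continuous_loss _ _)

lemma integrable_cumViol [IsProbabilityMeasure P] (hR : 0 ≤ R) (hx₁ : ∀ j, x₁ j ∈ decisionSet k R)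
    (hu : ∀ t < T, ∀ j, Measurable (u t j))
    (hind : iIndepFun (fun (p : Fin T × Fin n) => u p.1 p.2) P) :
    Integrable (fun ω => cumViol T k
      (run W k R η reg ε ξ h z x₁ (fun t j => u t j ω))) P := by
  refine integrable_finsetSum _ fun t ht => integrable_finsetSum _ fun i _ =>
    integrable_finsetSum _ fun q _ => ?_
  exact integrable_continuous_comp
    (measurable_indepFun_run hR hx₁ hu hind (Finset.mem_range.1 ht) i).1
    (fun ω => norm_run_le hR hx₁ (le_max_left R (|1 - ξ| * R)) (le_max_right _ _) _ t i)
    (continuous_viol _)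

end Noise

/-! ### Trivial bounds, for shrinkage parameters larger than one. -/

section Crude

variable {n m s : ℕ} {k : Fin s → Vec m} {K ρ α_h α_z : ℝ} {X : ℕ → Fin n → Vec m} {T : ℕ}
  {h : ℕ → Fin n → Vec m} {z : ℕ → Fin n → ℝ}

lemma totalLoss_sub_le_of_norm_le {ystar : Vec m} (h0 : 0 ≤ α_h) (hz0 : 0 ≤ α_z) (hρ : 0 ≤ ρ)
    (hdata : ∀ t < T, ∀ j, ‖h t j‖ ^ 2 ≤ α_h ∧ |z t j| ≤ α_z) (hXρ : ∀ t i, ‖X t i‖ ≤ ρ)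
    (hy : ‖ystar‖ ≤ ρ) (i : Fin n) :
    totalLoss T h z (fun t => X t i) - totalLoss T h z (fun _ => ystar) ≤
      n * T * ((α_h * ρ + Real.sqrt α_h * α_z) * (2 * ρ)) := by
  rw [totalLoss, totalLoss, ← Finset.sum_sub_distrib, ← sum_const_rounds]
  refine Finset.sum_le_sum fun t ht => ?_
  rw [← Finset.sum_sub_distrib]
  refine Finset.sum_le_sum fun j _ => ?_
  have hd := hdata t (Finset.mem_range.1 ht) j
  refine (loss_sub_le_norm hd.1 hd.2 (hXρ t i)).trans
    (mul_le_mul_of_nonneg_left ?_ (by positivity))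
  have := norm_sub_le (X t i) ystar
  linarith [hXρ t i]

lemma sum_viol_le_of_norm_le (hk : ∀ q, ‖k q‖ ≤ K) (hXρ : ∀ t i, ‖X t i‖ ≤ ρ) :
    ∑ t ∈ Finset.range T, ∑ i, ∑ q, viol (k q) (X t i) ≤ n * T * (s * (K * ρ)) := by
  rw [← sum_const_rounds]
  refine Finset.sum_le_sum fun t _ => Finset.sum_le_sum fun i _ => ?_
  calc _ ≤ ∑ _q : Fin s, K * ρ := Finset.sum_le_sum fun q _ => viol_le (hk q) (hXρ t i)
    _ = _ := by simp

end Crude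

/-- The constant in the bounds for shrinkage parameters larger than `1`. -/
noncomputable def crudeConst (s : ℕ) (δ : ℝ) : ℝ :=
  2 * (1 + 1 / δ) ^ 2 / δ + s * (1 + 1 / δ) / δ ^ 2

lemma regretConst_nonneg {s : ℕ} {c δ : ℝ} (hc : 1 < c) (hδ : 0 < δ) :
    0 ≤ regretConst s c δ := by
  have hc1 : 0 < c - 1 := sub_pos.2 hc
  unfold regretConst
  positivity

lemma violConst_nonneg {s : ℕ} {c δ : ℝ} (hc : 1 < c) (hδ : 0 < δ) :
    0 ≤ violConst s c δ := by
  have hc1 : 0 < c - 1 := sub_pos.2 hc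
  unfold violConst
  positivity

lemma crudeConst_nonneg {s : ℕ} {δ : ℝ} (hδ : 0 < δ) : 0 ≤ crudeConst s δ := by
  unfold crudeConst
  positivity

/-- Turns pathwise bounds into bounds in expectation: centred noise drops out whatever its
coefficient. -/
lemma integral_le_of_add_mul_le {Ω : Type*} [MeasurableSpace Ω] {P : Measure Ω}
    [IsProbabilityMeasure P] {F N : Ω → ℝ} {a B : ℝ} (hF : Integrable F P) (hN : Integrable N P)
    (hN0 : ∫ ω, N ω ∂P = 0) (hB : ∀ᵐ ω ∂P, F ω + a * N ω ≤ B) : ∫ ω, F ω ∂P ≤ B := by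
  have h1 := integral_mono_ae (hF.add (hN.const_mul a)) (integrable_const B) hB
  simp only [Pi.add_apply] at h1
  rw [integral_add hF (hN.const_mul a), integral_const_mul, hN0] at h1
  simpa using h1

lemma ae_norm_eq_one {n m T : ℕ} {Ω : Type*} [MeasurableSpace Ω] {P : Measure Ω}
    {u : ℕ → Fin n → Ω → Vec m}
    (hu : ∀ t < T, ∀ j, Measurable (u t j) ∧ P.map (u t j) = uniformSphere m) :
    ∀ᵐ ω ∂P, ∀ t < T, ∀ j, ‖u t j ω‖ = 1 := by
  rw [ae_all_iff]
  intro t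
  by_cases ht : t < T
  · simp only [ht, true_imp_iff]
    rw [ae_all_iff]
    intro j
    have := ae_norm_eq_one_uniformSphere (m := m)
    rw [← (hu t ht j).2] at this
    exact ae_of_ae_map (hu t ht j).1.aemeasurable this
  · simp [ht]

end DOLR

/-! ### The theorem: choice of parameters and passage to expectations. -/

set_option maxHeartbeats 1000000 in
theorem theorem5 (s : ℕ) (hs : 1 ≤ s) (c : ℝ) (hc : 1 < c) (δ : ℝ) (hδ : 0 < δ) :
    -- the constant hidden in the two `O(·)`
    ∃ C : ℝ,
      ∀ (n m : ℕ) (_ : 1 ≤ m)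
        -- the network
        (G : Digraph (Fin n)) (W : Matrix (Fin n) (Fin n) ℝ) (_ : DOLR.IsNetwork G W)
        -- the constraints
        (R K_I : ℝ) (_ : δ ≤ R) (_ : δ ≤ K_I)
        (k : Fin s → DOLR.Vec m) (_ : ∀ q, ‖k q‖ ≤ K_I)
        -- horizon and data
        (T : ℕ) (_ : 2 ≤ T) (α_h α_z L : ℝ)
        (_ : L = α_h * R + Real.sqrt α_h * α_z) (_ : δ ≤ L)
        (h : ℕ → Fin n → DOLR.Vec m) (z : ℕ → Fin n → ℝ)
        (_ : ∀ t < T, ∀ j, ‖h t j‖ ^ 2 ≤ α_h ∧ |z t j| ≤ α_z)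
        (_ : ∃ t < T, (Matrix.of fun (j : Fin n) (a : Fin m) => h t j a).rank = m)
        -- parameters of the algorithm
        (β γ η reg ε ξ : ℝ) (_ : 0 < β) (_ : β < 1) (_ : β ≤ γ)
        (_ : η = 1 / (c * s * K_I ^ 2 * (T : ℝ) ^ β)) (_ : reg = 1 / (T : ℝ) ^ β)
        (_ : ε = 1 / (T : ℝ) ^ γ) (_ : ξ = 1 / (R * (T : ℝ) ^ γ))
        -- initial estimates and offline optimum
        (x₁ : Fin n → DOLR.Vec m) (_ : ∀ j, x₁ j ∈ DOLR.decisionSet k R)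
        (ystar : DOLR.Vec m) (_ : ystar ∈ DOLR.decisionSet k R)
        (_ : IsMinOn (fun y => DOLR.totalLoss T h z (fun _ => y)) (DOLR.decisionSet k R) ystar)
        -- independent random directions, uniform on the unit sphere
        (Ω : Type*) (_ : MeasurableSpace Ω) (P : Measure Ω) (_ : IsProbabilityMeasure P)
        (u : ℕ → Fin n → Ω → DOLR.Vec m)
        (_ : ∀ t < T, ∀ j, Measurable (u t j) ∧ P.map (u t j) = DOLR.uniformSphere m)
        (_ : iIndepFun (fun (p : Fin T × Fin n) => u p.1 p.2) P)
        -- the random run of the algorithm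
        (S : Ω → ℕ → DOLR.State n m s)
        (_ : ∀ ω, S ω = DOLR.run W k R η reg ε ξ h z x₁ (fun t j => u t j ω)),
        ((∀ j, 0 < W j j) → DOLR.sigma2 W < 1) ∧
        (DOLR.sigma2 W < 1 →
          (∀ i : Fin n,
            Integrable (fun ω => DOLR.regret T h z ystar (S ω) i) P ∧
            ∫ ω, DOLR.regret T h z ystar (S ω) i ∂P ≤
              C * (1 / (1 - DOLR.sigma2 W) ^ 2 *
                    ((m : ℝ) ^ 2 * (n : ℝ) ^ (5 / 2 : ℝ) * L ^ 2 + (n : ℝ) ^ (5 / 2 : ℝ) * L * R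
                      + (n : ℝ) ^ 4 * L ^ 2)
                  + n * K_I ^ 2 * R ^ 2) * (T : ℝ) ^ max β (1 - β)) ∧
          Integrable (fun ω => DOLR.cumViol T k (S ω)) P ∧
          ∫ ω, DOLR.cumViol T k (S ω) ∂P ≤
            C * (m * n * L * K_I * R) * (T : ℝ) ^ (1 - β / 2)) := by
  refine ⟨DOLR.regretConst s c δ + DOLR.violConst s c δ + DOLR.crudeConst s δ, ?_⟩
  intro n m hm G W hW R K hRδ hK k hk T hT α_h α_z L hL hLδ h z hdata hrank β γ η reg ε ξ hβ0 hβ1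
    hβγ hη hreg hε hξ x₁ hx₁ ystar hystar _ Ω _ P _ u hu hind S hS
  refine ⟨hW.sigma2_lt_one, fun hσ => ?_⟩
  obtain rfl : S = fun ω => DOLR.run W k R η reg ε ξ h z x₁ (fun t j => u t j ω) := funext hS
  have hR0 : 0 < R := hδ.trans_le hRδ
  have hK0 : 0 < K := hδ.trans_le hK
  have hL0 : 0 < L := hδ.trans_le hLδ
  -- The rank condition with `m ≥ 1` rules out an empty network.
  have hn : 1 ≤ n := by
    obtain ⟨t, -, ht⟩ := hrank
    have := (Matrix.of fun (j : Fin n) (a : Fin m) => h t j a).rank_le_height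
    omega
  have hn1 : (1 : ℝ) ≤ n := by exact_mod_cast hn
  have hm1 : (1 : ℝ) ≤ m := by exact_mod_cast hm
  have hs1 : (1 : ℝ) ≤ s := by exact_mod_cast hs
  have hT1 : (1 : ℝ) ≤ T := by exact_mod_cast (by omega : 1 ≤ T)
  have hT0 : (0 : ℝ) < T := one_pos.trans_le hT1
  have hα : 0 ≤ α_h := (sq_nonneg _).trans (hdata 0 (by omega) ⟨0, hn⟩).1
  have hαz : 0 ≤ α_z := (abs_nonneg _).trans (hdata 0 (by omega) ⟨0, hn⟩).2
  have hIr := DOLR.integrable_regret (W := W) (η := η) (reg := reg) (ε := ε) (ξ := ξ) (h := h)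
    (z := z) hR0.le hx₁ (fun t ht j => (hu t ht j).1) hind ystar
  have hIv := DOLR.integrable_cumViol (W := W) (η := η) (reg := reg) (ε := ε) (ξ := ξ) (h := h)
    (z := z) hR0.le hx₁ (fun t ht j => (hu t ht j).1) hind
  set τ := (T : ℝ) ^ β with hτ
  set Q := (T : ℝ) ^ (1 - β) with hQ
  set p := (T : ℝ) ^ max β (1 - β) with hp
  set ρ := (T : ℝ) ^ (β / 2) with hρ
  have hτ1 : 1 ≤ τ := Real.one_le_rpow hT1 hβ0.le
  have hQ1 : 1 ≤ Q := Real.one_le_rpow hT1 (by linarith)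
  have hτp : τ ≤ p := Real.rpow_le_rpow_of_exponent_le hT1 (le_max_left _ _)
  have hQp : Q ≤ p := Real.rpow_le_rpow_of_exponent_le hT1 (le_max_right _ _)
  have hτ0 : 0 < τ := one_pos.trans_le hτ1
  have hρ0 : 0 < ρ := Real.rpow_pos_of_pos hT0 _
  have hQτ : Q * τ = T := by
    rw [hQ, hτ, ← Real.rpow_add hT0, sub_add_cancel, Real.rpow_one]
  have hρτ : ρ ^ 2 = τ := by
    rw [hρ, hτ, ← Real.rpow_natCast, ← Real.rpow_mul hT0.le]
    congr 1
    push_cast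
    ring
  have hTρ : (T : ℝ) ^ (1 - β / 2) = T / ρ := by rw [Real.rpow_sub hT0, Real.rpow_one]
  have hTγ : τ ≤ (T : ℝ) ^ γ := Real.rpow_le_rpow_of_exponent_le hT1 hβγ
  have hTγ0 : 0 < (T : ℝ) ^ γ := hτ0.trans_le hTγ
  set w := 1 / (1 - DOLR.sigma2 W) ^ 2 with hw
  have hσ1 : 0 < 1 - DOLR.sigma2 W := sub_pos.2 hσ
  have hw1 : 1 ≤ w := by
    rw [hw, le_div_iff₀ (by positivity), one_mul]
    exact pow_le_one₀ hσ1.le (by linarith [DOLR.sigma2_nonneg W])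
  have hC1 : DOLR.regretConst s c δ ≤
      DOLR.regretConst s c δ + DOLR.violConst s c δ + DOLR.crudeConst s δ := by
    linarith [DOLR.violConst_nonneg (s := s) hc hδ, DOLR.crudeConst_nonneg (s := s) hδ]
  have hC2 : DOLR.violConst s c δ ≤
      DOLR.regretConst s c δ + DOLR.violConst s c δ + DOLR.crudeConst s δ := by
    linarith [DOLR.regretConst_nonneg (s := s) hc hδ, DOLR.crudeConst_nonneg (s := s) hδ]
  have hC3 : DOLR.crudeConst s δ ≤
      DOLR.regretConst s c δ + DOLR.violConst s c δ + DOLR.crudeConst s δ := by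
    linarith [DOLR.regretConst_nonneg (s := s) hc hδ, DOLR.violConst_nonneg (s := s) hc hδ]
  set C := DOLR.regretConst s c δ + DOLR.violConst s c δ + DOLR.crudeConst s δ
  have hC0 : 0 ≤ C := (DOLR.crudeConst_nonneg hδ).trans hC3
  set F := w * ((m : ℝ) ^ 2 * (n : ℝ) ^ (5 / 2 : ℝ) * L ^ 2 + (n : ℝ) ^ (5 / 2 : ℝ) * L * R
    + (n : ℝ) ^ 4 * L ^ 2) + n * K ^ 2 * R ^ 2 with hF
  have hF0 : 0 ≤ F := by positivity
  have hp0 : 0 ≤ p := hτ0.le.trans hτp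
  rcases le_or_gt ξ 1 with hξ1 | hξ1
  · have hr : 0 ≤ |1 - ξ| * R := by positivity
    have hξ0 : 0 ≤ ξ := by rw [hξ]; positivity
    have habs : |1 - ξ| = 1 - ξ := abs_of_nonneg (sub_nonneg.2 hξ1)
    have hrR : |1 - ξ| * R ≤ R := by rw [habs]; nlinarith
    have hRr : R - |1 - ξ| * R = 1 / (T : ℝ) ^ γ := by
      rw [habs, hξ]; field_simp; ring
    have hrτ : (R - |1 - ξ| * R) * reg⁻¹ ≤ 1 := by
      rw [hRr, hreg, one_div, one_div, inv_inv, ← div_eq_inv_mul]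
      exact (div_le_one hTγ0).2 hTγ
    have hregτ : reg⁻¹ = τ := by rw [hreg, one_div, inv_inv]
    rw [hregτ] at hrτ
    have hε0 : ε ≠ 0 := by rw [hε]; positivity
    have hη0 : 0 < η := by rw [hη]; positivity
    have hητ : η * τ * (s * K ^ 2) * c = 1 := by rw [hη]; field_simp
    -- The comparator must lie in the shrunk ball; scaling keeps it feasible and moves it by at most
    -- `ξ * R = 1 / T ^ γ`.
    set y := (1 - ξ) • ystar with hy
    have hyr : ‖y‖ ≤ |1 - ξ| * R := by
      rw [hy, norm_smul, Real.norm_eq_abs]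
      exact mul_le_mul_of_nonneg_left hystar.2 (abs_nonneg _)
    have hky : ∀ q, inner ℝ (k q) y ≤ 0 := by
      intro q
      rw [hy, real_inner_smul_right]
      exact mul_nonpos_of_nonneg_of_nonpos (sub_nonneg.2 hξ1) (hystar.1 q)
    have hyy : ‖y - ystar‖ ≤ R - |1 - ξ| * R := by
      have e : y - ystar = -(ξ • ystar) := by rw [hy, sub_smul, one_smul]; abel
      rw [e, norm_neg, norm_smul, Real.norm_of_nonneg hξ0, habs]
      have := mul_le_mul_of_nonneg_left hystar.2 hξ0
      linarith
    obtain ⟨hN, hN0⟩ := DOLR.integral_noise (W := W) (η := η) (reg := reg) (ξ := ξ) (h := h)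
      (z := z) hm hε0 hR0.le hx₁ hu hind y
    have hXR := fun ω => DOLR.norm_run_le (W := W) (η := η) (reg := reg) (ε := ε) (h := h)
      (z := z) hR0.le hx₁ le_rfl hrR (fun t j => u t j ω)
    have htraj := fun ω => DOLR.isTrajectory_run (W := W) (η := η) (reg := reg) (ε := ε) (ξ := ξ)
      (h := h) (z := z) hR0.le hx₁ (fun t j => u t j ω)
    rw [hregτ] at htraj
    have hgrad : ∀ᵐ ω ∂P, ∀ t < T, ∀ j, ‖DOLR.gradEst ε (DOLR.loss (h t j) (z t j)) (u t j ω)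
        ((DOLR.run W k R η reg ε ξ h z x₁ (fun t j => u t j ω) t).x j)‖ ≤ m * L := by
      filter_upwards [DOLR.ae_norm_eq_one hu] with ω hω t ht j
      rw [hL]
      exact DOLR.norm_gradEst_loss_le hε0 (hdata t ht j).1 (hdata t ht j).2 (hXR ω t j)
        (hω t ht j)
    refine ⟨fun i => ⟨hIr i, ?_⟩, hIv, ?_⟩
    · refine DOLR.integral_le_of_add_mul_le (a := 1) (hIr i) hN hN0 ?_
      filter_upwards [hgrad] with ω hω
      rw [one_mul]
      refine ((htraj ω).regret_add_noise_le hn hm hW hσ hk hc hs hδ hK hη0 hτ0 hητ hQ1 hQτ hQp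
        hτp hr hrR hrτ (hXR ω) hL hLδ hRδ hdata hω hyr hky hyy i).trans ?_
      gcongr
    · refine DOLR.integral_le_of_add_mul_le (a := (m * L * K * R * ρ)⁻¹) hIv hN hN0 ?_
      filter_upwards [hgrad] with ω hω
      rw [hTρ]
      refine ((htraj ω).sum_viol_add_noise_le hn hm hW hk hc hs hδ hK hη0 hτ1 hητ hQ1 hQτ
        hρ0 hρτ hr hrR (hXR ω) hL hLδ hRδ hdata hω hyr hky).trans ?_
      gcongr
  -- Here `R * T ^ γ < 1`, so `T ^ β` is bounded and the trivial bounds lose only powers of `1 / δ`.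
  · have hTδ : τ ≤ 1 / δ := by
      rw [hξ, one_lt_div (by positivity)] at hξ1
      rw [le_div_iff₀ hδ]
      calc τ * δ ≤ (T : ℝ) ^ γ * R := by gcongr
        _ ≤ 1 := by linarith
    have hρτ' : ρ ≤ τ := Real.rpow_le_rpow_of_exponent_le hT1 (by linarith)
    -- The projection ball has radius `(ξ - 1) * R`, which may exceed `R`.
    have hball : |1 - ξ| * R ≤ R * (1 + 1 / δ) := by
      rw [abs_of_nonpos (by linarith)]
      have h1 : ξ * R ≤ 1 := by
        have : ξ * R = 1 / (T : ℝ) ^ γ := by rw [hξ]; field_simp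
        rw [this]
        exact (div_le_one hTγ0).2 (hτ1.trans hTγ)
      have h2 : 1 ≤ R * (1 / δ) := by
        rw [mul_one_div]; exact (one_le_div hδ).2 hRδ
      linarith
    have hRρ : R ≤ R * (1 + 1 / δ) := le_mul_of_one_le_right hR0.le (by
      have : 0 < 1 / δ := by positivity
      linarith)
    have hXρ := fun ω => DOLR.norm_run_le (W := W) (η := η) (reg := reg) (ε := ε) (h := h)
      (z := z) hR0.le hx₁ hRρ hball (fun t j => u t j ω)
    have hmean : ∀ {f : Ω → ℝ} {B : ℝ}, Integrable f P → (∀ ω, f ω ≤ B) →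
        ∫ ω, f ω ∂P ≤ B := fun hf hB =>
      DOLR.integral_le_of_add_mul_le (a := 0) (N := 0) hf (integrable_zero _ _ _) (by simp)
        (Filter.Eventually.of_forall fun ω => by simpa using hB ω)
    refine ⟨fun i => ⟨hIr i, hmean (hIr i) fun ω => ?_⟩, hIv, hmean hIv fun ω => ?_⟩
    · refine (DOLR.totalLoss_sub_le_of_norm_le hα hαz (hR0.le.trans hRρ) hdata (hXρ ω)
        (hystar.2.trans hRρ) i).trans ?_
      have h1 : α_h * (R * (1 + 1 / δ)) + Real.sqrt α_h * α_z ≤ (1 + 1 / δ) * L := by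
        rw [hL]
        have : 0 ≤ Real.sqrt α_h * α_z * (1 / δ) := by positivity
        linarith
      have hnp : (n : ℝ) ≤ (n : ℝ) ^ (5 / 2 : ℝ) := by
        nth_rewrite 1 [← Real.rpow_one (n : ℝ)]
        exact Real.rpow_le_rpow_of_exponent_le hn1 (by norm_num)
      have h2 : (n : ℝ) * L * R ≤ F := by
        calc (n : ℝ) * L * R = 1 * (0 + (n : ℝ) * L * R + 0) + 0 := by ring
          _ ≤ F := by rw [hF]; gcongr <;> positivity
      have h3 : 2 * (1 + 1 / δ) ^ 2 / δ ≤ DOLR.crudeConst s δ :=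
        le_add_of_nonneg_right (by positivity)
      calc (n : ℝ) * T * ((α_h * (R * (1 + 1 / δ)) + Real.sqrt α_h * α_z)
            * (2 * (R * (1 + 1 / δ))))
          ≤ n * (Q * (1 / δ)) * ((1 + 1 / δ) * L * (2 * (R * (1 + 1 / δ)))) := by
            rw [← hQτ]; gcongr
        _ = 2 * (1 + 1 / δ) ^ 2 / δ * (n * L * R) * Q := by ring
        _ ≤ C * F * p := by
            have := h3.trans hC3
            gcongr
    · refine (DOLR.sum_viol_le_of_norm_le hk (hXρ ω)).trans ?_
      have h3 : s * (1 + 1 / δ) / δ ^ 2 ≤ DOLR.crudeConst s δ :=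
        le_add_of_nonneg_left (by positivity)
      have h4 : 1 ≤ m * L / δ := by
        rw [one_le_div hδ]
        exact hLδ.trans (le_mul_of_one_le_left hL0.le hm1)
      have h5 : (T : ℝ) ≤ T / ρ * (1 / δ) := by
        calc (T : ℝ) = T / ρ * ρ := by field_simp
          _ ≤ _ := by gcongr; exact hρτ'.trans hTδ
      rw [hTρ]
      calc (n : ℝ) * T * (s * (K * (R * (1 + 1 / δ))))
          = n * T * (s * (K * (R * (1 + 1 / δ)))) * 1 := by ring
        _ ≤ n * (T / ρ * (1 / δ)) * (s * (K * (R * (1 + 1 / δ)))) * (m * L / δ) := by gcongr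
        _ = s * (1 + 1 / δ) / δ ^ 2 * (m * n * L * K * R) * (T / ρ) := by
            field_simp
        _ ≤ C * (m * n * L * K * R) * (T / ρ) := by
            have := h3.trans hC3
            gcongr
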